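/- Let $\langle D\rangle\in\mathbb Z[A^{\pm1}]$ be the Kauffman bracket of a link diagram $D$ in the sphere: a crossing is $A$ times its positive smoothing (the one merging the two regions swept out when the over-strand turns counterclockwise) plus $A^{-1}$ times its negative smoothing, a disjoint circle contributes a factor $-A^2-A^{-2}$, and $\langle\emptyset\rangle=1$. The Jones polynomial $J_2(D)\in\mathbb Z[q^{\pm1}]$ is defined, up to multiplication by $\pm q^m$, by $J_2(D)(A^4)\cdot(-A^2-A^{-2})=\pm A^{m'}\langle D\rangle$ for some sign and some $m'\in\mathbb Z$. For $P,Q\in\mathbb Z[q^{-1}][[q]]$ write $P\doteq_n Q$ if the first $n$ coefficients of $P$ and $Q$, counted from the lowest nonzero coefficient on, agree up to a common sign. A sequence $(P_i)_{i\ge0}$ in $\mathbb Z[q^{-1}][[q]]$ stabilizes with rate $f$, for a strictly increasing $f:\mathbb N\to\mathbb N$, if there is $T\in\mathbb Z[[q]]$, called a tail of the sequence, with $T\doteq_{f(i)}P_i$ for all $i\ge 0$. A negative twist region with $k\ge1$ crossings is a vertical column of $k$ crossings, consecutive ones joined by the two sides of a bigon, such that the negative smoothing of each crossing consists of two vertical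 strands (and the positive one of a cup over a cap). Let $L=L(k_1,\dots,k_r)$, $r\ge1$, be an alternating link diagram with $r$ pairwise disjoint marked negative twist regions (for example, some or all of its maximal ones), the $j$-th having $k_j\ge1$ crossings, and let $L(k_1+i,\dots,k_r+i)$ be the diagram obtained by replacing the $j$-th marked region by one with $k_j+i$ crossings, for each $j$. Then the Jones polynomial $J_2(L(k_1+i,\dots,k_r+i))\in\mathbb Z[q^{\pm1}]$ exists for every $i\ge 0$, and the sequence $\{J_2(L(k_1+i,\dots,k_r+i))\}_{i\in\mathbb N}$ stabilizes with rate $f(i)=k+i+1$, where $k=\min_{1\le j\le r}k_j$. In particular it has a tail, and the tail is well defined: any two tails $T,T'$ of the sequence, for whatever rates, satisfy $T\doteq_n T'$ for all $n$. This includes the case $r=1$ of a single marked twist region. -/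

import Mathlib

open scoped LaurentPolynomial

/-! ## Link diagrams -/

/-- The combinatorial code of a link diagram on an oriented surface, with set of crossings `X`.
The four ends of the crossing `x` are `(x, 0), (x, 1), (x, 2), (x, 3)` in counterclockwise order;
`0, 2` are the ends of the under-strand and `1, 3` those of the over-strand. The arcs of the
diagram join the ends in pairs according to `glue`; `circles` counts the components of the
diagram that run through no crossing. -/
structure DiagramCode (X : Type*) where
  glue : X × Fin 4 → X × Fin 4
  glue_glue : ∀ h, glue (glue h) = h
  glue_ne : ∀ h, glue h ≠ h
  circles : ℕ

namespace DiagramCode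

variable {X : Type*}

/-- Number of faces of the underlying 4-valent map (summed over its connected components): walk
along an arc, then turn to the counterclockwise next end of the crossing reached. -/
noncomputable def faceCount (D : DiagramCode X) : ℕ :=
  Nat.card (Quot fun h h' : X × Fin 4 => h' = ((D.glue h).1, (D.glue h).2 + 1))

/-- Number of connected components of the underlying 4-valent graph. -/
noncomputable def componentCount (D : DiagramCode X) : ℕ :=
  Nat.card (Quot fun x y : X => ∃ a b : Fin 4, D.glue (x, a) = (y, b))

/-- The code is that of a link diagram in the sphere (plane): `V - E + F = 2 C`, where `V` is the
number of crossings, `E = 2 V` the number of arcs, `F` the number of faces and `C` the number of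
connected components. -/
def IsPlanar [Fintype X] (D : DiagramCode X) : Prop :=
  D.faceCount = Fintype.card X + 2 * D.componentCount

/-- The diagram is alternating: every arc joins an over-end to an under-end. -/
def IsAlternating (D : DiagramCode X) : Prop :=
  ∀ h, ((D.glue h).2 : ℕ) % 2 ≠ (h.2 : ℕ) % 2

/-! ## The Kauffman bracket and the Jones polynomial -/

/-- The two smoothings of a crossing, as pairings of its four ends. The positive one (`true`)
merges the two regions swept out by the over-strand when it turns counterclockwise, so it joins
`0` to `1` and `2` to `3`; the negative one (`false`) joins `1` to `2` and `3` to `0`. -/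
def smoothing (positive : Bool) (a : Fin 4) : Fin 4 :=
  if positive then 1 - a else 3 - a

/-- The number of circles of the diagram obtained by smoothing each crossing `x` as `s x` says. -/
noncomputable def stateCircles (D : DiagramCode X) (s : X → Bool) : ℕ :=
  Nat.card (Quot fun h h' : X × Fin 4 => h' = D.glue h ∨ h' = (h.1, smoothing (s h.1) h.2))
    + D.circles

/-- The Kauffman bracket, a Laurent polynomial in `A` (written `T`): a positive smoothing has
weight `A`, a negative one `A⁻¹`, a circle has value `-A² - A⁻²`, the empty diagram value `1`. -/
noncomputable def bracket [Fintype X] [DecidableEq X] (D : DiagramCode X) : ℤ[T;T⁻¹] :=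
  ∑ s : X → Bool,
    LaurentPolynomial.T (∑ x, if s x then 1 else -1) *
      (-LaurentPolynomial.T 2 - LaurentPolynomial.T (-2)) ^ D.stateCircles s

/-- `P(q)` is the Jones polynomial `J₂` of the diagram, which is defined up to a unit:
`P(A⁴) · Δ₁ = ± A ^ m · ⟨D⟩` for some sign and some `m`, where `Δ₁ = -A² - A⁻²`. -/
def IsJonesPolynomial [Fintype X] [DecidableEq X] (D : DiagramCode X) (P : ℤ[T;T⁻¹]) : Prop :=
  ∃ (ε : ℤˣ) (m : ℤ),
    AddMonoidAlgebra.mapDomain (fun j : ℤ => 4 * j) P *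
        (-LaurentPolynomial.T 2 - LaurentPolynomial.T (-2)) =
      LaurentPolynomial.C (ε : ℤ) * LaurentPolynomial.T m * D.bracket

/-! ## Twist regions -/

/-- A negative twist region with `k` crossings. Each crossing `c t` is seen with the end
`(c t, bottom t)` at the lower left, hence with `bottom t + 1, bottom t + 2, bottom t + 3` at the
lower right, upper right and upper left. The crossings are stacked in a vertical column:
consecutive ones are joined by the two sides of a bigon. As `bottom t` is an under-end, the
negative smoothing of a crossing yields two vertical strands and the positive one a cup
over a cap. -/
structure NegativeTwistRegion (D : DiagramCode X) (k : ℕ) where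
  pos : 1 ≤ k
  crossing : Fin k → X
  crossing_injective : Function.Injective crossing
  bottom : Fin k → Fin 4
  bottom_under : ∀ t, bottom t = 0 ∨ bottom t = 2
  glue_right : ∀ (t : ℕ) (h : t + 1 < k),
    D.glue (crossing ⟨t, by lia⟩, bottom ⟨t, by lia⟩ + 2) =
      (crossing ⟨t + 1, h⟩, bottom ⟨t + 1, h⟩ + 1)
  glue_left : ∀ (t : ℕ) (h : t + 1 < k),
    D.glue (crossing ⟨t, by lia⟩, bottom ⟨t, by lia⟩ + 3) =
      (crossing ⟨t + 1, h⟩, bottom ⟨t + 1, h⟩)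

/-- The last (top) crossing of a twist region. -/
def NegativeTwistRegion.top {D : DiagramCode X} {k : ℕ} (R : D.NegativeTwistRegion k) : X :=
  R.crossing ⟨k - 1, Nat.sub_lt R.pos Nat.one_pos⟩

/-- When each crossing `x` is replaced by a column of `e x + 1` crossings, the place of the
end `h` of the old diagram: the ends `0, 1` are at the bottom and `2, 3` at the top. -/
def outerEnd (e : X → ℕ) (h : X × Fin 4) : (Σ x, Fin (e x + 1)) × Fin 4 :=
  (⟨h.1, if h.2 < 2 then 0 else Fin.last (e h.1)⟩, h.2)

/-- The arcs after each crossing `x` is replaced by a column of `e x + 1` crossings. Inside a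
column the ends `3, 2` of a crossing are joined to the ends `0, 1` of the next one. -/
def columnGlue (D : DiagramCode X) (e : X → ℕ) (h : (Σ x, Fin (e x + 1)) × Fin 4) :
    (Σ x, Fin (e x + 1)) × Fin 4 :=
  if h.2 < 2 then
    if h.1.2 = 0 then outerEnd e (D.glue (h.1.1, h.2))
    else (⟨h.1.1, ⟨h.1.2 - 1, by lia⟩⟩, 3 - h.2)
  else
    if hl : (h.1.2 : ℕ) = e h.1.1 then outerEnd e (D.glue (h.1.1, h.2))
    else (⟨h.1.1, ⟨h.1.2 + 1, by lia⟩⟩, 3 - h.2)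

theorem columnGlue_outerEnd (D : DiagramCode X) (e : X → ℕ) (h : X × Fin 4) :
    D.columnGlue e (outerEnd e h) = outerEnd e (D.glue h) := by
  obtain ⟨x, a⟩ := h
  by_cases ha : a < 2
  · have h1 : outerEnd e (x, a) = (⟨x, 0⟩, a) := by simp [outerEnd, ha]
    rw [h1]
    simp [columnGlue, ha]
  · have h1 : outerEnd e (x, a) = (⟨x, Fin.last (e x)⟩, a) := by simp [outerEnd, ha]
    rw [h1]
    simp [columnGlue, ha]

theorem columnGlue_cases (D : DiagramCode X) (e : X → ℕ) (h : (Σ x, Fin (e x + 1)) × Fin 4) :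
    (∃ g, h = outerEnd e g) ∨
      (D.columnGlue e (D.columnGlue e h) = h ∧ D.columnGlue e h ≠ h) := by
  obtain ⟨⟨x, t, ht⟩, a⟩ := h
  by_cases ha : a < 2
  · have ha' : ¬ (3 - a < 2) := by revert ha; revert a; decide
    by_cases h0 : t = 0
    · subst h0
      exact Or.inl ⟨(x, a), by simp [outerEnd, ha]⟩
    · right
      have h0' : (⟨t, ht⟩ : Fin (e x + 1)) ≠ 0 := fun h => h0 (by simpa using congrArg Fin.val h)
      have h1 : D.columnGlue e (⟨x, ⟨t, ht⟩⟩, a) = (⟨x, ⟨t - 1, by lia⟩⟩, 3 - a) := by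
        simp [columnGlue, ha, h0']
      rw [h1]
      have h2 : t - 1 ≠ e x := by lia
      have h3 : t - 1 + 1 = t := by lia
      constructor
      · simp [columnGlue, ha', h2, h3]
      · intro h
        exact ha' (by rw [show 3 - a = a from congrArg Prod.snd h]; exact ha)
  · have ha' : 3 - a < 2 := by revert ha; revert a; decide
    by_cases h0 : t = e x
    · subst h0
      exact Or.inl ⟨(x, a), by simp [outerEnd, ha, Fin.last]⟩
    · right
      have h1 : D.columnGlue e (⟨x, ⟨t, ht⟩⟩, a) = (⟨x, ⟨t + 1, by lia⟩⟩, 3 - a) := by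
        simp [columnGlue, ha, h0]
      rw [h1]
      have h0' : (⟨t + 1, by lia⟩ : Fin (e x + 1)) ≠ 0 := fun h => by
        simpa using congrArg Fin.val h
      constructor
      · simp [columnGlue, ha', h0']
      · intro h
        exact ha (by rw [← show 3 - a = a from congrArg Prod.snd h]; exact ha')

/-- The diagram in which each crossing `x` is replaced by a vertical column of `e x + 1`
crossings, that is, in which `e x` further negative twists are inserted at `x`. -/
def insertTwists (D : DiagramCode X) (e : X → ℕ) : DiagramCode (Σ x, Fin (e x + 1)) where
  glue := D.columnGlue e
  glue_glue h := by
    rcases D.columnGlue_cases e h with ⟨g, rfl⟩ | h'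
    · rw [columnGlue_outerEnd, columnGlue_outerEnd, D.glue_glue]
    · exact h'.1
  glue_ne h := by
    rcases D.columnGlue_cases e h with ⟨g, rfl⟩ | h'
    · rw [columnGlue_outerEnd]
      intro hg
      apply D.glue_ne g
      have h1 := congrArg (fun z => z.1.1) hg
      have h2 := congrArg (fun z => z.2) hg
      exact Prod.ext h1 h2
    · exact h'.2
  circles := D.circles

/-- How many crossings are inserted at `x` in passing from `L(k₁, …, k_r)` to
`L(k₁ + b₁, …, k_r + b_r)`: the new crossings of the `j`-th region go next to its top crossing. -/
def extraTwists [DecidableEq X] {D : DiagramCode X} {r : ℕ} {k : Fin r → ℕ}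
    (R : ∀ j, D.NegativeTwistRegion (k j)) (b : Fin r → ℕ) (x : X) : ℕ :=
  ∑ j, if (R j).top = x then b j else 0

/-- `L(k₁ + b₁, …, k_r + b_r)`, where `L = L(k₁, …, k_r)` has the twist regions `R j`. -/
def twist [DecidableEq X] (D : DiagramCode X) {r : ℕ} {k : Fin r → ℕ}
    (R : ∀ j, D.NegativeTwistRegion (k j)) (b : Fin r → ℕ) :
    DiagramCode (Σ x, Fin (extraTwists R b x + 1)) :=
  D.insertTwists (extraTwists R b)

end DiagramCode

/-! ## Stabilization of sequences of power series -/

/-- A Laurent polynomial as a formal Laurent series. -/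
noncomputable def laurentPolynomialToSeries (P : ℤ[T;T⁻¹]) : LaurentSeries ℤ :=
  HahnSeries.ofFinsupp P.coeff

/-- `P ≐ₙ Q`: the first `n` coefficients, from the lowest nonzero one on, agree up to a common
sign. -/
def EquivUpTo (n : ℕ) (P Q : LaurentSeries ℤ) : Prop :=
  ∃ ε : ℤˣ, ∀ j : ℕ, j < n → P.coeff (P.order + j) = ε * Q.coeff (Q.order + j)

/-- `T ∈ ℤ⟦q⟧` satisfies `T ≐_{f i} P i` for all `i`, where `f` is increasing. -/
def IsTailWithRate (P : ℕ → LaurentSeries ℤ) (f : ℕ → ℕ) (T : PowerSeries ℤ) : Prop :=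
  StrictMono f ∧ ∀ i, EquivUpTo (f i) (HahnSeries.ofPowerSeries ℤ ℤ T) (P i)

/-- The sequence `P` stabilizes with rate `f`. -/
def StabilizesWithRate (P : ℕ → LaurentSeries ℤ) (f : ℕ → ℕ) : Prop :=
  ∃ T, IsTailWithRate P f T

/-! Let `G` be the graph whose vertices are the `v` circles of the all-negative state through
crossings and whose edges are the crossings; let `κ(S)` be the number of components of `G` with only
the edges in `S`. Attaching a band for each crossing of `S` to disks on the vertices gives a surface
bounded by the circles of the state positive on `S`. Twice its genus is `2κ(S) + |S| - v -
loops(S)`. This grows with `S` (`genus_mono`), vanishes at `S = ∅`, and is `≤ 0` at the full set,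
because the faces of an alternating planar diagram are circles of the two extreme states
(`joinCount_univ_le_of_isPlanar`). So it is always zero (`loops_add_eq`), and the bracket becomes a
sum over edge sets: up to sign and a power of `q`, `J · (1+q)^(v+1) = (1+q)^circles · ∑_S q^(v-κ(S))
(1+q)^(2κ(S)) w^|S|` with `w = -(1+q)` (`jonesSum_mul`).

Inserting twists multiplies edges into parallel ones (`joinCount_insertTwists`), and the crossings
of a twist region are parallel already (`NegativeTwistRegion.joinRel_pair`). As `κ(S)` depends only
on the classes of parallel edges that `S` meets, a met class of `N` edges contributes in total
`(1+w)^N - 1 = (-q)^N - 1` (`sum_image_eq`). Loops of `G` split off monomials `(-q)^N`. The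
remaining sum `edgeSum` has constant term `1`, because a nonempty set of non-loops has `κ(S) < v`.
The tail arises by replacing `(-q)^N` by `0` for every marked class. There `N ≥ k + i`, and the
factor `q^(v-κ(S))` supplies one more power of `q`: hence the rate `k + i + 1`. The factor
`(1+q)^(v+1)` is a unit in power series. -/

section QuotCard

/-! ### Counting classes when one pair is identified. -/

variable {α β : Type*}

theorem card_quot_le [Finite α] {r r' : α → α → Prop}
    (h : ∀ a b, r a b → Quot.mk r' a = Quot.mk r' b) :
    Nat.card (Quot r') ≤ Nat.card (Quot r) := by
  refine Nat.card_le_card_of_surjective (Quot.lift (Quot.mk r') h) ?_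
  rintro ⟨a⟩
  exact ⟨Quot.mk r a, rfl⟩

/-- The relation `r` with one further pair. -/
def addPair (r : α → α → Prop) (a b : α) (x y : α) : Prop := r x y ∨ (x = a ∧ y = b)

theorem card_quot_le_addPair_add_one [Finite α] (r : α → α → Prop) (a b : α) :
    Nat.card (Quot r) ≤ Nat.card (Quot (addPair r a b)) + 1 := by
  classical
  rw [← Finite.card_option]
  -- Redirecting the class of `a` to that of `b` respects the new pair; only the class of `a` may
  -- then be missed, and `none` covers it.
  let g : Quot (addPair r a b) → Quot r :=
    Quot.lift (fun x => if Quot.mk r x = Quot.mk r a then Quot.mk r b else Quot.mk r x) (by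
      rintro x y (h | ⟨rfl, rfl⟩)
      · simp [Quot.sound h]
      · simp)
  refine Nat.card_le_card_of_surjective (fun o => o.elim (Quot.mk r a) g) ?_
  rintro ⟨x⟩
  by_cases hx : Quot.mk r x = Quot.mk r a
  · exact ⟨none, hx.symm⟩
  · exact ⟨some (Quot.mk _ x), by simp [g, hx]⟩

theorem card_quot_le_addPair [Finite α] {r : α → α → Prop} {a b : α}
    (h : Quot.mk r a = Quot.mk r b) : Nat.card (Quot r) ≤ Nat.card (Quot (addPair r a b)) := by
  apply card_quot_le
  rintro x y (h' | ⟨rfl, rfl⟩)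
  · exact Quot.sound h'
  · exact h

theorem card_quot_addPair_lt [Finite α] {r : α → α → Prop} {a b : α}
    (h : Quot.mk r a ≠ Quot.mk r b) : Nat.card (Quot (addPair r a b)) < Nat.card (Quot r) := by
  have hs : Function.Surjective (Quot.factor r (addPair r a b) fun _ _ => Or.inl) := by
    rintro ⟨x⟩
    exact ⟨Quot.mk r x, rfl⟩
  by_contra! hle
  exact h ((hs.bijective_of_nat_card_le hle).1 (Quot.sound (Or.inr ⟨rfl, rfl⟩)))

end QuotCard

/-! ### State circles and the genus of the state surface. -/

namespace DiagramCode

variable {X : Type*} (D : DiagramCode X)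

/-- The relation whose classes are the circles of the state `s`. -/
def stateRel (s : X → Bool) (h h' : X × Fin 4) : Prop :=
  h' = D.glue h ∨ h' = (h.1, smoothing (s h.1) h.2)

/-- The number of circles of the state `s` that run through a crossing. -/
noncomputable def loops (s : X → Bool) : ℕ := Nat.card (Quot (D.stateRel s))

/-- The relation on the ends whose classes are the components of the following graph: the vertices
are the circles of the all-negative state and the edges are the crossings in `S`. -/
def joinRel (S : Finset X) (h h' : X × Fin 4) : Prop :=
  h' = D.glue h ∨ h' = (h.1, smoothing false h.2) ∨ (h.1 ∈ S ∧ h'.1 = h.1)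

/-- The number of components of the graph with the circles of the all-negative state as vertices
and the crossings in `S` as edges. -/
noncomputable def joinCount (S : Finset X) : ℕ := Nat.card (Quot (D.joinRel S))

theorem stateCircles_eq (s : X → Bool) : D.stateCircles s = D.loops s + D.circles := rfl

variable {D}

theorem stateRel_glue (s : X → Bool) (h : X × Fin 4) :
    Quot.mk (D.stateRel s) (D.glue h) = Quot.mk (D.stateRel s) h :=
  (Quot.sound (r := D.stateRel s) (Or.inl rfl)).symm

theorem stateRel_smoothing (s : X → Bool) (x : X) (a : Fin 4) :
    Quot.mk (D.stateRel s) (x, smoothing (s x) a) = Quot.mk (D.stateRel s) (x, a) :=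
  (Quot.sound (r := D.stateRel s) (a := (x, a)) (Or.inr rfl)).symm

theorem joinRel_glue (S : Finset X) (h : X × Fin 4) :
    Quot.mk (D.joinRel S) (D.glue h) = Quot.mk (D.joinRel S) h :=
  (Quot.sound (r := D.joinRel S) (Or.inl rfl)).symm

theorem joinRel_smoothing (S : Finset X) (x : X) (a : Fin 4) :
    Quot.mk (D.joinRel S) (x, smoothing false a) = Quot.mk (D.joinRel S) (x, a) :=
  (Quot.sound (r := D.joinRel S) (a := (x, a)) (Or.inr (Or.inl rfl))).symm

theorem joinRel_mem {S : Finset X} {x : X} (hx : x ∈ S) (a b : Fin 4) :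
    Quot.mk (D.joinRel S) (x, a) = Quot.mk (D.joinRel S) (x, b) :=
  Quot.sound (Or.inr (Or.inr ⟨hx, rfl⟩))

theorem joinCount_anti [Finite X] {S S' : Finset X} (h : S ⊆ S') : D.joinCount S' ≤ D.joinCount S :=
  card_quot_le fun _ _ hr =>
    Quot.sound (hr.imp_right fun hr => hr.imp_right fun hr => ⟨h hr.1, hr.2⟩)

theorem smoothing_smoothing (p : Bool) (a : Fin 4) : smoothing p (smoothing p a) = a := by
  revert p a; decide

theorem smoothing_parity (p : Bool) (a : Fin 4) :
    ((smoothing p a : Fin 4) : ℕ) % 2 ≠ (a : ℕ) % 2 := by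
  revert p a; decide

variable (D) in
/-- One step along a circle of the state `s`: along an arc, then along the smoothing. -/
def step (s : X → Bool) (h : X × Fin 4) : X × Fin 4 :=
  ((D.glue h).1, smoothing (s (D.glue h).1) (D.glue h).2)

theorem step_injective (s : X → Bool) : Function.Injective (D.step s) := by
  have h1 : Function.LeftInverse D.glue D.glue := D.glue_glue
  have h2 : Function.LeftInverse (fun h : X × Fin 4 => (h.1, smoothing (s h.1) h.2))
      (fun h : X × Fin 4 => (h.1, smoothing (s h.1) h.2)) := fun h => by
    simp [smoothing_smoothing]
  exact h2.injective.comp h1.injective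

theorem stateRel_step (s : X → Bool) (h : X × Fin 4) :
    Quot.mk (D.stateRel s) (D.step s h) = Quot.mk (D.stateRel s) h :=
  (stateRel_smoothing s _ _).trans (stateRel_glue s h)

theorem stateRel_iterate_step (s : X → Bool) (h : X × Fin 4) (n : ℕ) :
    Quot.mk (D.stateRel s) ((D.step s)^[n] h) = Quot.mk (D.stateRel s) h := by
  induction n with
  | zero => rfl
  | succ n ih => rw [Function.iterate_succ_apply', stateRel_step, ih]

/-- In an alternating diagram both the arc and the smoothing switch between over- and under-ends.
This orients all circles of all states coherently. -/
theorem step_parity (halt : D.IsAlternating) (s : X → Bool) (h : X × Fin 4) :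
    ((D.step s h).2 : ℕ) % 2 = (h.2 : ℕ) % 2 := by
  have h1 := halt h
  have h2 := smoothing_parity (s (D.glue h).1) (D.glue h).2
  simp only [step]
  lia

theorem iterate_step_parity (halt : D.IsAlternating) (s : X → Bool) (h : X × Fin 4) (n : ℕ) :
    (((D.step s)^[n] h).2 : ℕ) % 2 = (h.2 : ℕ) % 2 := by
  induction n with
  | zero => rfl
  | succ n ih => rw [Function.iterate_succ_apply', step_parity halt, ih]

variable [DecidableEq X]

/-- Two circles of an alternating diagram that meet at a negatively smoothed crossing are merged
when the smoothing is changed. -/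
theorem stateRel_update_merge [Finite X] (halt : D.IsAlternating) {s : X → Bool} {x : X}
    (hs : s x = false)
    (hne : Quot.mk (D.stateRel s) (x, 0) ≠ Quot.mk (D.stateRel s) (x, 2)) :
    Quot.mk (D.stateRel (Function.update s x true)) (x, 0) =
      Quot.mk (D.stateRel (Function.update s x true)) (x, 2) := by
  set s' := Function.update s x true with hs'
  -- By parity, a walk from the end `2` of `x` can return to `x` only at `0` or `2`, and `0` lies on
  -- the other circle. So the circle meets `x` only where it closes up.
  have hret : ∀ n, (D.glue ((D.step s)^[n] (x, 2))).1 = x → (D.step s)^[n + 1] (x, 2) = (x, 2) := by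
    intro n hx
    have hx' : ((D.step s)^[n + 1] (x, 2)).1 = x := by
      rw [Function.iterate_succ_apply']; exact hx
    have hpar := iterate_step_parity halt s (x, 2) (n + 1)
    have hmk := stateRel_iterate_step (D := D) s (x, 2) (n + 1)
    generalize (D.step s)^[n + 1] (x, 2) = z at hx' hpar hmk ⊢
    obtain ⟨y, c⟩ := z
    obtain rfl : y = x := hx'
    have hc : c = 0 ∨ c = 2 := by
      change (c : ℕ) % 2 = ((2 : Fin 4) : ℕ) % 2 at hpar
      clear hmk
      revert hpar; revert c; decide
    rcases hc with rfl | rfl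
    · exact absurd hmk hne
    · rfl
  have key : ∀ n, Quot.mk (D.stateRel s') ((D.step s)^[n] (x, 2)) =
      Quot.mk (D.stateRel s') (x, 2) := by
    intro n
    induction n with
    | zero => rfl
    | succ n ih =>
      by_cases hx : (D.glue ((D.step s)^[n] (x, 2))).1 = x
      · rw [hret n hx]
      · rw [Function.iterate_succ_apply', ← ih, ← stateRel_step s' ((D.step s)^[n] (x, 2))]
        simp [step, hs', Function.update_of_ne hx]
  have hper : (x, (2 : Fin 4)) ∈ Function.periodicPts (D.step s) :=
    (step_injective s).mem_periodicPts _
  obtain ⟨n, hn, hp⟩ := hper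
  obtain ⟨m, rfl⟩ : ∃ m, n = m + 1 := ⟨n - 1, by lia⟩
  have hp' : D.step s ((D.step s)^[m] (x, 2)) = (x, 2) := by
    rw [← Function.iterate_succ_apply' (D.step s)]; exact hp
  -- The walk re-enters `x` through the end that the negative smoothing joins to `2`; the positive
  -- smoothing joins this end to `0` instead.
  have hg : D.glue ((D.step s)^[m] (x, 2)) = (x, 1) := by
    have h1 : (D.glue ((D.step s)^[m] (x, 2))).1 = x := congrArg Prod.fst hp'
    have h2 := congrArg Prod.snd hp'
    simp only [step, h1, hs] at h2
    refine Prod.ext h1 ?_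
    change (D.glue ((D.step s)^[m] (x, 2))).2 = 1
    generalize (D.glue ((D.step s)^[m] (x, 2))).2 = c at h2
    revert h2; revert c; decide
  rw [← key m, ← stateRel_glue s' ((D.step s)^[m] (x, 2)), hg, ← stateRel_smoothing s' x 1]
  simp [hs', smoothing]

/-- Once `0` and `2` are identified, either smoothing puts all four ends of `x` into one class, so
the choice of smoothing no longer matters. -/
theorem stateRel_update_le [Finite X] (s : X → Bool) (x : X) :
    ∀ b b' : Bool,
    Nat.card (Quot (addPair (D.stateRel (Function.update s x b)) (x, 0) (x, 2))) ≤
      Nat.card (Quot (addPair (D.stateRel (Function.update s x b')) (x, 0) (x, 2))) := by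
  intro b b'
  have hall : ∀ (b : Bool) (a a' : Fin 4),
      Quot.mk (addPair (D.stateRel (Function.update s x b)) (x, 0) (x, 2)) (x, a) =
      Quot.mk (addPair (D.stateRel (Function.update s x b)) (x, 0) (x, 2)) (x, a') := by
    intro b
    have h02 : Quot.mk (addPair (D.stateRel (Function.update s x b)) (x, 0) (x, 2)) (x, 0) =
        Quot.mk (addPair (D.stateRel (Function.update s x b)) (x, 0) (x, 2)) (x, 2) :=
      Quot.sound (Or.inr ⟨rfl, rfl⟩)
    have hsm : ∀ a, Quot.mk (addPair (D.stateRel (Function.update s x b)) (x, 0) (x, 2)) (x, a) =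
        Quot.mk (addPair (D.stateRel (Function.update s x b)) (x, 0) (x, 2)) (x, smoothing b a) :=
      fun a => Quot.sound (Or.inl (Or.inr (by simp)))
    have h0 : ∀ a, Quot.mk (addPair (D.stateRel (Function.update s x b)) (x, 0) (x, 2)) (x, a) =
        Quot.mk (addPair (D.stateRel (Function.update s x b)) (x, 0) (x, 2)) (x, 0) := by
      have e1 := hsm 1
      have e3 := hsm 3
      intro a
      fin_cases a
      · rfl
      · cases b
        · exact e1.trans h02.symm
        · exact e1
      · exact h02.symm
      · cases b
        · exact e3
        · exact e3.trans h02.symm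
    intro a a'
    rw [h0 a, h0 a']
  apply card_quot_le
  rintro ⟨y, a⟩ h' ((rfl | rfl) | ⟨h1, rfl⟩)
  · exact Quot.sound (Or.inl (Or.inl rfl))
  · by_cases hy : y = x
    · subst hy
      exact hall b _ _
    · refine Quot.sound (Or.inl (Or.inr ?_))
      simp [Function.update_of_ne hy]
  · rw [h1]
    exact hall b _ _

theorem loops_update_le [Finite X] {s : X → Bool} {x : X} (hs : s x = false) :
    D.loops (Function.update s x true) ≤ D.loops s + 1 := by
  refine (card_quot_le_addPair_add_one _ (x, 0) (x, 2)).trans (Nat.add_le_add_right ?_ 1)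
  refine (stateRel_update_le s x true false).trans ?_
  rw [← hs, Function.update_eq_self]
  exact card_quot_le fun a b h => Quot.sound (Or.inl h)

theorem loops_update_lt [Finite X] (halt : D.IsAlternating) {s : X → Bool} {x : X}
    (hs : s x = false)
    (hne : Quot.mk (D.stateRel s) (x, 0) ≠ Quot.mk (D.stateRel s) (x, 2)) :
    D.loops (Function.update s x true) < D.loops s := by
  refine (card_quot_le_addPair (stateRel_update_merge halt hs hne)).trans_lt ?_
  refine (stateRel_update_le s x true false).trans_lt ?_
  rw [← hs, Function.update_eq_self]
  exact card_quot_addPair_lt hne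

/-- The state that is positive exactly at the crossings in `S`. -/
def stateOf (S : Finset X) (x : X) : Bool := decide (x ∈ S)

theorem stateOf_insert (S : Finset X) (x : X) :
    stateOf (insert x S) = Function.update (stateOf S) x true := by
  funext y
  by_cases h : y = x
  · subst h; simp [stateOf]
  · simp [stateOf, h]

theorem joinRel_of_stateRel (S : Finset X) {h h' : X × Fin 4} (hr : D.stateRel (stateOf S) h h') :
    Quot.mk (D.joinRel S) h = Quot.mk (D.joinRel S) h' := by
  obtain ⟨x, a⟩ := h
  rcases hr with rfl | rfl
  · exact (joinRel_glue S _).symm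
  · by_cases hx : x ∈ S
    · exact joinRel_mem hx _ _
    · simpa [stateOf, hx] using (joinRel_smoothing S x a).symm

theorem joinCount_insert_eq [Finite X] (S : Finset X) (x : X) :
    D.joinCount (insert x S) = Nat.card (Quot (addPair (D.joinRel S) (x, 0) (x, 2))) := by
  apply le_antisymm
  · apply card_quot_le
    rintro ⟨y, a⟩ h' ((h | h | ⟨h1, h2⟩) | ⟨h1, rfl⟩)
    · exact Quot.sound (Or.inl h)
    · exact Quot.sound (Or.inr (Or.inl h))
    · exact Quot.sound (Or.inr (Or.inr ⟨Finset.mem_insert_of_mem h1, h2⟩))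
    · rw [h1]
      exact joinRel_mem (Finset.mem_insert_self _ _) _ _
  · apply card_quot_le
    rintro ⟨y, a⟩ ⟨y', a'⟩ (h | h | ⟨h1, h2⟩)
    · exact Quot.sound (Or.inl (Or.inl h))
    · exact Quot.sound (Or.inl (Or.inr (Or.inl h)))
    · obtain rfl : y' = y := h2
      rcases Finset.mem_insert.1 h1 with h1 | h1
      · have h02 : Quot.mk (addPair (D.joinRel S) (x, 0) (x, 2)) (x, 0) =
            Quot.mk (addPair (D.joinRel S) (x, 0) (x, 2)) (x, 2) :=
          Quot.sound (Or.inr ⟨rfl, rfl⟩)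
        have hsm : ∀ a, Quot.mk (addPair (D.joinRel S) (x, 0) (x, 2)) (x, a) =
            Quot.mk (addPair (D.joinRel S) (x, 0) (x, 2)) (x, smoothing false a) :=
          fun a => Quot.sound (Or.inl (Or.inr (Or.inl rfl)))
        have h0 : ∀ a, Quot.mk (addPair (D.joinRel S) (x, 0) (x, 2)) (x, a) =
            Quot.mk (addPair (D.joinRel S) (x, 0) (x, 2)) (x, 0) := by
          intro a
          fin_cases a
          · rfl
          · exact (hsm 1).trans h02.symm
          · exact h02.symm
          · exact hsm 3
        obtain rfl : y' = x := h1
        rw [h0 a, h0 a']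
      · exact Quot.sound (Or.inl (Or.inr (Or.inr ⟨h1, rfl⟩)))

/-- The genus of the surface that the circles of a state bound does not decrease when a smoothing
is changed from negative to positive. -/
theorem genus_insert_le [Finite X] (halt : D.IsAlternating) {S : Finset X} {x : X} (hx : x ∉ S) :
    2 * D.joinCount S + D.loops (stateOf (insert x S)) ≤
      2 * D.joinCount (insert x S) + 1 + D.loops (stateOf S) := by
  have hs : stateOf S x = false := by simp [stateOf, hx]
  rw [stateOf_insert, joinCount_insert_eq]
  -- If the new edge joins a component to itself, the component count is unchanged and at most one
  -- circle is gained. Otherwise it joins two components, hence two distinct circles, which merge.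
  by_cases hj : Quot.mk (D.joinRel S) (x, 0) = Quot.mk (D.joinRel S) (x, 2)
  · have h1 := card_quot_le_addPair hj
    have h2 := loops_update_le (D := D) hs
    rw [joinCount]
    lia
  · have hne : Quot.mk (D.stateRel (stateOf S)) (x, 0) ≠ Quot.mk (D.stateRel (stateOf S)) (x, 2) :=
      fun h => hj (congrArg (Quot.lift (Quot.mk (D.joinRel S))
        fun _ _ => joinRel_of_stateRel S) h)
    have h1 := card_quot_le_addPair_add_one (D.joinRel S) (x, 0) (x, 2)
    have h2 := loops_update_lt halt hs hne
    rw [joinCount]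
    lia

theorem genus_mono [Finite X] (halt : D.IsAlternating) {S S' : Finset X} (h : S ⊆ S') :
    2 * D.joinCount S + S.card + D.loops (stateOf S') ≤
      2 * D.joinCount S' + S'.card + D.loops (stateOf S) := by
  suffices H : ∀ U : Finset X, Disjoint S U →
      2 * D.joinCount S + S.card + D.loops (stateOf (S ∪ U)) ≤
        2 * D.joinCount (S ∪ U) + (S ∪ U).card + D.loops (stateOf S) by
    simpa [Finset.union_sdiff_of_subset h] using H (S' \ S) Finset.disjoint_sdiff
  intro U
  induction U using Finset.induction_on with
  | empty => simp
  | insert x U hx ih =>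
    intro hd
    obtain ⟨hxS, hd⟩ := Finset.disjoint_insert_right.1 hd
    have hx' : x ∉ S ∪ U := by simp [hx, hxS]
    have h1 := genus_insert_le halt hx'
    have h2 := Finset.card_insert_of_notMem hx'
    have h3 := ih hd
    rw [Finset.union_insert]
    lia

theorem joinCount_empty : D.joinCount ∅ = D.loops (stateOf ∅) := by
  have : D.joinRel ∅ = D.stateRel (stateOf ∅) := by
    funext h h'
    simp [joinRel, stateRel, stateOf]
  rw [joinCount, loops, this]

/-- The number of circles of any state of an alternating diagram whose surface has genus zero. -/
theorem loops_add_eq [Fintype X] (halt : D.IsAlternating)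
    (hg : 2 * D.joinCount Finset.univ + Fintype.card X ≤
      D.joinCount ∅ + D.loops (stateOf Finset.univ)) (S : Finset X) :
    D.loops (stateOf S) + D.joinCount ∅ = 2 * D.joinCount S + S.card := by
  have h1 := genus_mono halt (Finset.empty_subset S)
  have h2 := genus_mono halt (Finset.subset_univ S)
  have h3 := joinCount_empty (D := D)
  simp only [Finset.card_empty, Finset.card_univ] at h1 h2
  lia

end DiagramCode

/-! ### Planarity forces genus zero. -/

namespace DiagramCode

variable {X : Type*} {D : DiagramCode X}

/-- Checkerboard colouring: a face walk preserves the parity of ends. The even faces are traced by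
circles of the all-negative state and the odd ones by circles of the all-positive state;
surjectivity suffices. -/
theorem faceCount_le [Finite X] [DecidableEq X] (halt : D.IsAlternating) :
    D.faceCount ≤ D.loops (stateOf ∅) + D.loops fun _ => true := by
  set r : X × Fin 4 → X × Fin 4 → Prop :=
    fun h h' => h' = ((D.glue h).1, (D.glue h).2 + 1) with hr
  have hface : ∀ h, Quot.mk r h = Quot.mk r ((D.glue h).1, (D.glue h).2 + 1) :=
    fun h => Quot.sound rfl
  -- A circle visits both ends of each arc, a face walk of parity `p` just one of them; an end of
  -- the wrong parity is replaced by its partner.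
  let rep (p : ℕ) (h : X × Fin 4) : Quot r :=
    if (h.2 : ℕ) % 2 = p then Quot.mk r h else Quot.mk r (D.glue h)
  have hglue : ∀ p, p < 2 → ∀ h, rep p h = rep p (D.glue h) := by
    intro p hp h
    have := halt h
    by_cases h1 : (h.2 : ℕ) % 2 = p
    · have h2 : ¬ ((D.glue h).2 : ℕ) % 2 = p := by lia
      simp [rep, h1, h2, D.glue_glue]
    · have h2 : ((D.glue h).2 : ℕ) % 2 = p := by lia
      simp [rep, h1, h2]
  have hsm : ∀ (b : Bool) (p : ℕ), p < 2 → (∀ a : Fin 4, (a : ℕ) % 2 ≠ p → smoothing b a = a + 1) →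
      ∀ x a, rep p (x, a) = rep p (x, smoothing b a) := by
    intro b p hp hb x
    have main : ∀ a : Fin 4, (a : ℕ) % 2 ≠ p → rep p (x, a) = rep p (x, smoothing b a) := by
      intro a ha
      have h1 := smoothing_parity b a
      have h2 : ((smoothing b a : Fin 4) : ℕ) % 2 = p := by lia
      have h3 := hface (D.glue (x, a))
      rw [D.glue_glue] at h3
      simp only [rep, ha, h2, if_true, if_false]
      rw [h3, hb a ha]
    intro a
    by_cases ha : (a : ℕ) % 2 = p
    · have h1 := smoothing_parity b a
      have h2 := main (smoothing b a) (by lia)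
      rw [smoothing_smoothing] at h2
      exact h2.symm
    · exact main a ha
  have h0 : ∀ h h', D.stateRel (stateOf ∅) h h' → rep 0 h = rep 0 h' := by
    rintro ⟨x, a⟩ h' (rfl | rfl)
    · exact hglue 0 (by lia) _
    · simp only [stateOf, Finset.notMem_empty, decide_false]
      exact hsm false 0 (by lia) (by decide) x a
  have h1 : ∀ h h', D.stateRel (fun _ => true) h h' → rep 1 h = rep 1 h' := by
    rintro ⟨x, a⟩ h' (rfl | rfl)
    · exact hglue 1 (by lia) _
    · exact hsm true 1 (by lia) (by decide) x a
  rw [faceCount, loops, loops, ← Nat.card_sum]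
  refine Nat.card_le_card_of_surjective (Sum.elim (Quot.lift (rep 0) h0) (Quot.lift (rep 1) h1)) ?_
  rintro ⟨h⟩
  by_cases hp : (h.2 : ℕ) % 2 = 0
  · exact ⟨Sum.inl (Quot.mk _ h), by simp [rep, hp]; rfl⟩
  · have hp : (h.2 : ℕ) % 2 = 1 := by lia
    exact ⟨Sum.inr (Quot.mk _ h), by simp [rep, hp]; rfl⟩

theorem joinCount_univ_le [Fintype X] : D.joinCount Finset.univ ≤ D.componentCount := by
  refine Nat.card_le_card_of_surjective (Quot.lift (fun x => Quot.mk _ (x, 0)) ?_) ?_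
  · rintro x y ⟨a, b, hab⟩
    rw [joinRel_mem (Finset.mem_univ x) 0 a, ← joinRel_glue, hab]
    exact joinRel_mem (Finset.mem_univ y) _ _
  · rintro ⟨x, a⟩
    exact ⟨Quot.mk _ x, joinRel_mem (Finset.mem_univ x) _ _⟩

theorem joinCount_univ_le_of_isPlanar [Fintype X] [DecidableEq X] (halt : D.IsAlternating)
    (hplanar : D.IsPlanar) :
    2 * D.joinCount Finset.univ + Fintype.card X ≤
      D.joinCount ∅ + D.loops fun _ => true := by
  have h1 := faceCount_le halt
  have h2 := joinCount_univ_le (D := D)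
  rw [IsPlanar] at hplanar
  rw [joinCount_empty]
  lia

/-! ### Inserting twists -/

variable (D) (e : X → ℕ)

theorem insertTwists_isAlternating (halt : D.IsAlternating) : (D.insertTwists e).IsAlternating := by
  have h3 : ∀ a : Fin 4, ((3 - a : Fin 4) : ℕ) % 2 ≠ (a : ℕ) % 2 := by decide
  rintro ⟨⟨x, t⟩, a⟩
  change ((D.columnGlue e (⟨x, t⟩, a)).2 : ℕ) % 2 ≠ (a : ℕ) % 2
  unfold columnGlue
  split_ifs
  · exact halt (x, a)
  · exact h3 a
  · exact halt (x, a)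
  · exact h3 a

theorem columnGlue_castSucc (x : X) (t : Fin (e x)) (a : Fin 4) (ha : ¬ a < 2) :
    D.columnGlue e (⟨x, t.castSucc⟩, a) = (⟨x, t.succ⟩, 3 - a) := by
  have h1 : (t : ℕ) ≠ e x := t.2.ne
  simp only [columnGlue, ha, if_false, Fin.val_castSucc, h1, dite_false]
  rfl

theorem columnGlue_succ (x : X) (t : Fin (e x)) (a : Fin 4) (ha : a < 2) :
    D.columnGlue e (⟨x, t.succ⟩, a) = (⟨x, t.castSucc⟩, 3 - a) := by
  simp [columnGlue, ha, Fin.succ_ne_zero]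
  rfl

/-- Negative smoothings leave two vertical strands running through the whole column. -/
theorem joinRel_column (S : Finset (Σ x, Fin (e x + 1))) (x : X) (t t' : Fin (e x + 1))
    (a : Fin 4) :
    Quot.mk ((D.insertTwists e).joinRel S) (⟨x, t⟩, a) =
      Quot.mk ((D.insertTwists e).joinRel S) (⟨x, t'⟩, a) := by
  have hup : ∀ (t : Fin (e x)) (a : Fin 4), ¬ a < 2 →
      Quot.mk ((D.insertTwists e).joinRel S) (⟨x, t.castSucc⟩, a) =
        Quot.mk ((D.insertTwists e).joinRel S) (⟨x, t.succ⟩, a) := by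
    intro t a ha
    rw [← joinRel_glue S (⟨x, t.castSucc⟩, a), ← joinRel_smoothing S ⟨x, t.succ⟩ a]
    exact congrArg _ (columnGlue_castSucc D e x t a ha)
  have hstep : ∀ (t : Fin (e x)) (a : Fin 4),
      Quot.mk ((D.insertTwists e).joinRel S) (⟨x, t.castSucc⟩, a) =
        Quot.mk ((D.insertTwists e).joinRel S) (⟨x, t.succ⟩, a) := by
    intro t a
    by_cases ha : a < 2
    · rw [← joinRel_smoothing S ⟨x, t.castSucc⟩ a, ← joinRel_smoothing S ⟨x, t.succ⟩ a]
      exact hup t _ (by revert ha; revert a; decide)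
    · exact hup t a ha
  have h0 : ∀ t : Fin (e x + 1), Quot.mk ((D.insertTwists e).joinRel S) (⟨x, t⟩, a) =
      Quot.mk ((D.insertTwists e).joinRel S) (⟨x, 0⟩, a) := by
    intro t
    induction t using Fin.induction with
    | zero => rfl
    | succ t ih => rw [← hstep, ih]
  rw [h0 t, h0 t']

variable [Fintype X]

/-- Each inserted crossing creates a bigon, which becomes a circle of its own in the all-positive
state. This offsets the growth of the crossing number in the genus bound. -/
theorem le_loops_insertTwists :
    (D.loops fun _ => true) + ∑ x, e x ≤ (D.insertTwists e).loops fun _ => true := by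
  have hcard : ∑ x, e x = Nat.card (Σ x, Fin (e x)) := by simp
  rw [hcard, loops, loops, ← Nat.card_sum]
  set r := D.stateRel fun _ => true
  -- Outer ends go to their old circle; the ends between the levels `t` and `t + 1` go to the bigon
  -- numbered `t`.
  let g : (Σ x, Fin (e x + 1)) × Fin 4 → Quot r ⊕ (Σ x, Fin (e x)) := fun h =>
    if h.2 < 2 then
      Fin.cases (motive := fun _ => Quot r ⊕ (Σ x, Fin (e x))) (Sum.inl (Quot.mk r (h.1.1, h.2)))
        (fun t => Sum.inr ⟨h.1.1, t⟩) h.1.2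
    else
      Fin.lastCases (motive := fun _ => Quot r ⊕ (Σ x, Fin (e x)))
        (Sum.inl (Quot.mk r (h.1.1, h.2))) (fun t => Sum.inr ⟨h.1.1, t⟩) h.1.2
  have hg : ∀ h, g (outerEnd e h) = Sum.inl (Quot.mk r h) := by
    rintro ⟨x, a⟩
    by_cases ha : a < 2
    · simp [g, outerEnd, ha]
    · simp [g, outerEnd, ha]
  have hsucc : ∀ x (t : Fin (e x)) (a : Fin 4), a < 2 → g (⟨x, t.succ⟩, a) = Sum.inr ⟨x, t⟩ := by
    intro x t a ha
    simp [g, ha]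
  have hcast : ∀ x (t : Fin (e x)) (a : Fin 4), ¬ a < 2 →
      g (⟨x, t.castSucc⟩, a) = Sum.inr ⟨x, t⟩ := by
    intro x t a ha
    simp [g, ha]
  have hinv : ∀ a : Fin 4, a < 2 → ¬ 3 - a < 2 := by decide
  have hinv' : ∀ a : Fin 4, ¬ a < 2 → 3 - a < 2 := by decide
  have hsm : ∀ a : Fin 4, smoothing true a < 2 ↔ a < 2 := by decide
  refine Nat.card_le_card_of_surjective (Quot.lift g ?_) ?_
  · rintro ⟨⟨x, t⟩, a⟩ h' (rfl | rfl)
    · change _ = g (D.columnGlue e _)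
      by_cases ha : a < 2
      · induction t using Fin.cases with
        | zero =>
          have h0 : ((⟨x, 0⟩, a) : (Σ x, Fin (e x + 1)) × Fin 4) = outerEnd e (x, a) := by
            simp [outerEnd, ha]
          rw [h0, columnGlue_outerEnd, hg, hg]
          exact congrArg Sum.inl (stateRel_glue _ _).symm
        | succ t => rw [columnGlue_succ D e x t a ha, hsucc x t a ha, hcast x t _ (hinv a ha)]
      · induction t using Fin.lastCases with
        | last =>
          have h0 : ((⟨x, Fin.last (e x)⟩, a) : (Σ x, Fin (e x + 1)) × Fin 4) =
              outerEnd e (x, a) := by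
            simp [outerEnd, ha]
          rw [h0, columnGlue_outerEnd, hg, hg]
          exact congrArg Sum.inl (stateRel_glue _ _).symm
        | cast t => rw [columnGlue_castSucc D e x t a ha, hcast x t a ha, hsucc x t _ (hinv' a ha)]
    · have hmk := stateRel_smoothing (D := D) (fun _ => true) x a
      by_cases ha : a < 2
      · have ha' := (hsm a).2 ha
        induction t using Fin.cases with
        | zero => simp [g, ha, ha', r, hmk]
        | succ t => simp [g, ha, ha']
      · have ha' : ¬ smoothing true a < 2 := fun h => ha ((hsm a).1 h)
        induction t using Fin.lastCases with
        | last => simp [g, ha, ha', r, hmk]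
        | cast t => simp [g, ha, ha']
  · rintro (q | ⟨x, t⟩)
    · obtain ⟨h, rfl⟩ := Quot.mk_surjective q
      exact ⟨Quot.mk _ (outerEnd e h), hg h⟩
    · exact ⟨Quot.mk _ (⟨x, t.succ⟩, 0), hsucc x t 0 (by decide)⟩

variable [DecidableEq X]

theorem joinCount_insertTwists (S : Finset (Σ x, Fin (e x + 1))) :
    (D.insertTwists e).joinCount S = D.joinCount (S.image Sigma.fst) := by
  apply le_antisymm
  · refine Nat.card_le_card_of_surjective
      (Quot.lift (fun h => Quot.mk _ (outerEnd e h)) ?_) ?_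
    · rintro ⟨x, a⟩ ⟨x', a'⟩ (h | h | ⟨h1, h2⟩)
      · rw [h, ← columnGlue_outerEnd]
        exact Quot.sound (Or.inl rfl)
      · rw [h]
        refine (joinRel_column D e S x _ 0 a).trans ?_
        rw [← joinRel_smoothing]
        exact joinRel_column D e S x _ _ _
      · obtain rfl : x' = x := h2
        obtain ⟨⟨y, t⟩, hy, rfl⟩ := Finset.mem_image.1 h1
        refine (joinRel_column D e S y _ t a).trans ?_
        rw [joinRel_mem hy a a']
        exact joinRel_column D e S y _ _ _
    · rintro ⟨⟨x, t⟩, a⟩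
      exact ⟨Quot.mk _ (x, a), joinRel_column D e S x _ _ _⟩
  · refine Nat.card_le_card_of_surjective
      (Quot.lift (fun h => Quot.mk _ (h.1.1, h.2)) ?_) ?_
    · rintro ⟨⟨x, t⟩, a⟩ ⟨⟨x', t'⟩, a'⟩ (h | h | ⟨h1, h2⟩)
      · rw [h]
        change _ = Quot.mk _ ((D.columnGlue e (⟨x, t⟩, a)).1.1, (D.columnGlue e (⟨x, t⟩, a)).2)
        have h3 : Quot.mk (D.joinRel (S.image Sigma.fst)) (x, a) =
            Quot.mk (D.joinRel (S.image Sigma.fst)) (x, 3 - a) :=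
          (joinRel_smoothing _ x a).symm
        unfold columnGlue
        split_ifs
        · exact (joinRel_glue _ (x, a)).symm
        · exact h3
        · exact (joinRel_glue _ (x, a)).symm
        · exact h3
      · rw [h]
        exact (joinRel_smoothing _ x a).symm
      · obtain ⟨rfl, -⟩ := Sigma.mk.inj h2
        exact joinRel_mem (Finset.mem_image_of_mem Sigma.fst h1) _ _
    · rintro ⟨h⟩
      exact ⟨Quot.mk _ (outerEnd e h), rfl⟩

/-- The number of circles of a state of a twisted planar alternating diagram. -/
theorem loops_insertTwists_add (halt : D.IsAlternating) (hplanar : D.IsPlanar)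
    (S : Finset (Σ x, Fin (e x + 1))) :
    (D.insertTwists e).loops (stateOf S) + D.joinCount ∅ =
      2 * D.joinCount (S.image Sigma.fst) + S.card := by
  have h0 := joinCount_insertTwists D e ∅
  rw [Finset.image_empty] at h0
  have hu : Finset.image Sigma.fst (Finset.univ : Finset (Σ x, Fin (e x + 1))) = Finset.univ :=
    Finset.eq_univ_iff_forall.2 fun x =>
      Finset.mem_image.2 ⟨⟨x, 0⟩, Finset.mem_univ _, rfl⟩
  have h1 := joinCount_insertTwists D e Finset.univ
  rw [hu] at h1
  rw [← joinCount_insertTwists, ← h0]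
  refine loops_add_eq (D.insertTwists_isAlternating e halt) ?_ S
  have h2 := joinCount_univ_le_of_isPlanar halt hplanar
  have h3 := le_loops_insertTwists D e
  have h4 : (stateOf Finset.univ : (Σ x, Fin (e x + 1)) → Bool) = fun _ => true := by
    funext x; simp [stateOf]
  have h5 : Fintype.card (Σ x, Fin (e x + 1)) = Fintype.card X + ∑ x, e x := by
    simp [Finset.sum_add_distrib, add_comm]
  rw [h0, h1, h4, h5]
  lia

/-! ### Twist regions consist of parallel edges -/

variable {D}

/-- The two vertical strands of the region are the endpoints of all its edges. The pair is unordered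
because a crossing may be seen upside down (`bottom t = 2`). -/
theorem NegativeTwistRegion.joinRel_pair {k : ℕ} (R : D.NegativeTwistRegion k) (S : Finset X)
    (t t' : Fin k) :
    s(Quot.mk (D.joinRel S) (R.crossing t, 0), Quot.mk (D.joinRel S) (R.crossing t, 2)) =
      s(Quot.mk (D.joinRel S) (R.crossing t', 0), Quot.mk (D.joinRel S) (R.crossing t', 2)) := by
  have hrot : ∀ t, s(Quot.mk (D.joinRel S) (R.crossing t, R.bottom t),
      Quot.mk (D.joinRel S) (R.crossing t, R.bottom t + 2)) =
      s(Quot.mk (D.joinRel S) (R.crossing t, 0), Quot.mk (D.joinRel S) (R.crossing t, 2)) := by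
    intro t
    rcases R.bottom_under t with h | h
    · rw [h]; rfl
    · rw [h]; exact Sym2.eq_swap
  have hpair : ∀ t, s(Quot.mk (D.joinRel S) (R.crossing t, R.bottom t),
        Quot.mk (D.joinRel S) (R.crossing t, R.bottom t + 2)) =
      s(Quot.mk (D.joinRel S) (R.crossing ⟨0, R.pos⟩, R.bottom ⟨0, R.pos⟩),
        Quot.mk (D.joinRel S) (R.crossing ⟨0, R.pos⟩, R.bottom ⟨0, R.pos⟩ + 2)) := by
    rintro ⟨t, ht⟩
    induction t with
    | zero => rfl
    | succ t ih =>
      rw [← ih (by lia)]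
      have h1 := R.glue_right t ht
      have h2 := R.glue_left t ht
      have s3 : ∀ t, smoothing false (R.bottom t) = R.bottom t + 3 := by
        intro t; rcases R.bottom_under t with h | h <;> rw [h] <;> rfl
      have s1 : ∀ t, smoothing false (R.bottom t + 2) = R.bottom t + 1 := by
        intro t; rcases R.bottom_under t with h | h <;> rw [h] <;> rfl
      refine congrArg₂ (fun u v => s(u, v)) ?_ ?_
      · rw [← h2, joinRel_glue, ← s3, joinRel_smoothing]
      · rw [← joinRel_smoothing S (R.crossing ⟨t + 1, ht⟩), s1, ← h1, joinRel_glue]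
  rw [← hrot t, ← hrot t', hpair t, hpair t']

/-- Replacing edges by parallel ones does not change connectivity. -/
theorem joinCount_image {p : X → X}
    (hp : ∀ (S : Finset X) (x : X),
      s(Quot.mk (D.joinRel S) (x, 0), Quot.mk (D.joinRel S) (x, 2)) =
        s(Quot.mk (D.joinRel S) (p x, 0), Quot.mk (D.joinRel S) (p x, 2))) (S : Finset X) :
    D.joinCount (S.image p) = D.joinCount S := by
  have hall : ∀ (S : Finset X) (x : X),
      Quot.mk (D.joinRel S) (x, 0) = Quot.mk (D.joinRel S) (x, 2) →
      ∀ a b, Quot.mk (D.joinRel S) (x, a) = Quot.mk (D.joinRel S) (x, b) := by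
    intro S x h
    have h0 : ∀ a, Quot.mk (D.joinRel S) (x, a) = Quot.mk (D.joinRel S) (x, 0) := by
      intro a
      fin_cases a
      · rfl
      · exact (joinRel_smoothing S x 1).symm.trans h.symm
      · exact h.symm
      · exact (joinRel_smoothing S x 3).symm
    intro a b
    rw [h0 a, h0 b]
  apply le_antisymm
  · apply card_quot_le
    rintro ⟨x, a⟩ ⟨x', a'⟩ (h | h | ⟨h1, h2⟩)
    · exact Quot.sound (Or.inl h)
    · exact Quot.sound (Or.inr (Or.inl h))
    · obtain rfl : x' = x := h2
      apply hall
      have h3 := hp (S.image p) x'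
      rw [joinRel_mem (Finset.mem_image_of_mem p h1) 0 2] at h3
      rcases Sym2.eq_iff.1 h3 with h | h <;> rw [h.1, h.2]
  · apply card_quot_le
    rintro ⟨x, a⟩ ⟨x', a'⟩ (h | h | ⟨h1, h2⟩)
    · exact Quot.sound (Or.inl h)
    · exact Quot.sound (Or.inr (Or.inl h))
    · obtain rfl : x' = x := h2
      obtain ⟨y, hy, rfl⟩ := Finset.mem_image.1 h1
      apply hall
      have h3 := hp S y
      rw [joinRel_mem hy 0 2] at h3
      rcases Sym2.eq_iff.1 h3 with h | h <;> rw [← h.1, ← h.2]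

/-- The crossing `x` is a loop of the graph of the circles of the all-negative state. -/
def IsLoop (D : DiagramCode X) (x : X) : Prop :=
  Quot.mk (D.joinRel ∅) (x, 0) = Quot.mk (D.joinRel ∅) (x, 2)

theorem joinCount_insert_of_isLoop {x : X} (hx : D.IsLoop x) (S : Finset X) :
    D.joinCount (insert x S) = D.joinCount S := by
  refine (joinCount_anti (Finset.subset_insert x S)).antisymm ?_
  rw [joinCount_insert_eq]
  exact card_quot_le_addPair (congrArg (Quot.lift (Quot.mk (D.joinRel S)) fun _ _ hr =>
    Quot.sound (hr.imp_right fun hr => hr.imp_right fun hr => absurd hr.1 (by simp))) hx)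

theorem joinCount_lt_of_not_isLoop {x : X} (hx : ¬ D.IsLoop x) {S : Finset X} (hS : x ∈ S) :
    D.joinCount S < D.joinCount ∅ := by
  refine (joinCount_anti (S := insert x ∅) (by simpa using hS)).trans_lt ?_
  rw [joinCount_insert_eq]
  exact card_quot_addPair_lt hx

end DiagramCode

/-! ### Sums over sets of parallel edges -/

section Sums

variable {R X Y : Type*} [CommRing R] [DecidableEq X] [DecidableEq Y]

/-- A weighted sum over sets of edges whose summands only depend on the parallelism classes
that are met. -/
theorem sum_image_eq [Fintype X] [Fintype Y] (p : X → Y) (w : R) (f : Finset Y → R) :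
    ∑ S : Finset X, f (S.image p) * w ^ S.card =
      ∑ U : Finset Y, f U * ∏ y ∈ U, ((1 + w) ^ (Finset.univ.filter fun x => p x = y).card - 1) := by
  -- Summed over all `V ⊆ U`, both sides are `(1 + w)` to the number of edges over `U`. The
  -- identities for single `V` follow by strong induction, as this system is triangular.
  have hsub : ∀ U : Finset Y, ∑ V ∈ U.powerset, ∑ S : Finset X with S.image p = V, w ^ S.card =
      ∑ V ∈ U.powerset, ∏ y ∈ V, ((1 + w) ^ (Finset.univ.filter fun x => p x = y).card - 1) := by
    intro U
    rw [← Finset.prod_add_one]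
    simp only [sub_add_cancel]
    rw [Finset.prod_pow_eq_pow_sum, Finset.sum_card_fiberwise_eq_card_filter]
    rw [Finset.sum_fiberwise_eq_sum_filter]
    have := Finset.sum_pow_mul_eq_add_pow w (1 : R) (Finset.univ.filter fun x => p x ∈ U)
    rw [add_comm 1 w, ← this]
    refine Finset.sum_congr ?_ fun S _ => by simp
    ext S
    simp [Finset.subset_iff]
  have hcoef : ∀ U : Finset Y, ∑ S : Finset X with S.image p = U, w ^ S.card =
      ∏ y ∈ U, ((1 + w) ^ (Finset.univ.filter fun x => p x = y).card - 1) := by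
    intro U
    induction U using Finset.strongInduction with
    | H U ih =>
      have h := hsub U
      rw [← Finset.insert_erase (Finset.mem_powerset_self U), Finset.sum_insert (by simp),
        Finset.sum_insert (by simp)] at h
      have h2 : ∀ V ∈ U.powerset.erase U, V ⊂ U := fun V hV =>
        (Finset.mem_powerset.1 (Finset.mem_of_mem_erase hV)).ssubset_of_ne (Finset.ne_of_mem_erase hV)
      rw [Finset.sum_congr rfl fun V hV => ih V (h2 V hV)] at h
      exact add_right_cancel h
  rw [← Finset.sum_fiberwise Finset.univ (fun S : Finset X => S.image p)]
  refine Finset.sum_congr rfl fun U _ => ?_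
  rw [← hcoef, Finset.mul_sum]
  refine Finset.sum_congr rfl fun S hS => ?_
  rw [(Finset.mem_filter.1 hS).2]

/-- Loops contribute factors to a weighted sum over sets of edges. -/
theorem sum_powerset_union_loops (A B : Finset X) (hAB : Disjoint A B) (f : Finset X → R)
    (hf : ∀ x ∈ B, ∀ S, f (insert x S) = f S) (w : X → R) :
    ∑ S ∈ (A ∪ B).powerset, f S * ∏ x ∈ S, w x =
      (∏ x ∈ B, (1 + w x)) * ∑ S ∈ A.powerset, f S * ∏ x ∈ S, w x := by
  induction B using Finset.induction_on with
  | empty => simp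
  | insert x B hx ih =>
    obtain ⟨hxA, hd⟩ := Finset.disjoint_insert_right.1 hAB
    have hx' : x ∉ A ∪ B := by simp [hx, hxA]
    rw [Finset.union_insert, Finset.sum_powerset_insert hx', Finset.prod_insert hx, mul_assoc,
      ← ih hd (fun y hy => hf y (Finset.mem_insert_of_mem hy)), add_mul, one_mul]
    congr 1
    rw [Finset.mul_sum]
    refine Finset.sum_congr rfl fun S hS => ?_
    have hxS : x ∉ S := fun h => hx' (Finset.mem_powerset.1 hS h)
    rw [Finset.prod_insert hxS, hf x (Finset.mem_insert_self _ _)]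
    ring

theorem dvd_prod_sub_prod {R X : Type*} [CommRing R] {d : R} (S : Finset X) (a b : X → R) (h : ∀ x ∈ S, d ∣ a x - b x) :
    d ∣ ∏ x ∈ S, a x - ∏ x ∈ S, b x := by
  rw [← Ideal.mem_span_singleton, ← Ideal.Quotient.eq, map_prod, map_prod]
  exact Finset.prod_congr rfl fun x hx =>
    Ideal.Quotient.eq.2 (Ideal.mem_span_singleton.2 (h x hx))

end Sums

/-! ### Laurent polynomials and Laurent series -/

/-- The inclusion of Laurent polynomials into Laurent series, as a ring homomorphism. -/
noncomputable def laurentPolynomialToSeriesHom : ℤ[T;T⁻¹] →+* LaurentSeries ℤ :=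
  (AddMonoidAlgebra.lift ℤ (LaurentSeries ℤ) ℤ
    { toFun := fun n => HahnSeries.single n.toAdd 1
      map_one' := rfl
      map_mul' := fun m n => by simp }).toRingHom

theorem laurentPolynomialToSeriesHom_apply (P : ℤ[T;T⁻¹]) :
    laurentPolynomialToSeriesHom P = laurentPolynomialToSeries P := by
  induction P using LaurentPolynomial.induction_on' with
  | add p q hp hq =>
    rw [map_add, hp, hq]
    ext n
    simp [laurentPolynomialToSeries]
  | C_mul_T n a =>
    rw [← LaurentPolynomial.single_eq_C_mul_T]
    refine (AddMonoidAlgebra.lift_single _ n a).trans ?_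
    rw [Algebra.smul_def, eq_intCast, ← zsmul_eq_mul]
    ext m
    change (a • HahnSeries.single n (1 : ℤ)).coeff m = (Finsupp.single n a) m
    rw [HahnSeries.coeff_smul]
    by_cases h : m = n
    · subst h
      simp
    · simp [h]

theorem laurentPolynomialToSeries_T (n : ℤ) :
    laurentPolynomialToSeries (LaurentPolynomial.T n) = HahnSeries.single n 1 := by
  ext m
  change (Finsupp.single n (1 : ℤ)) m = (HahnSeries.single n (1 : ℤ)).coeff m
  by_cases h : m = n
  · subst h
    simp
  · simp [h]

theorem laurentPolynomialToSeries_toLaurent (p : Polynomial ℤ) :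
    laurentPolynomialToSeries (Polynomial.toLaurent p) =
      HahnSeries.ofPowerSeries ℤ ℤ (p : PowerSeries ℤ) := by
  rw [← laurentPolynomialToSeriesHom_apply]
  have : laurentPolynomialToSeriesHom.comp Polynomial.toLaurent =
      (HahnSeries.ofPowerSeries ℤ ℤ).comp Polynomial.coeToPowerSeries.ringHom := by
    refine Polynomial.ringHom_ext' (RingHom.ext_int _ _) ?_
    simp [laurentPolynomialToSeriesHom_apply, laurentPolynomialToSeries_T]
  exact RingHom.congr_fun this p

/-! ### Equality up to sign and order -/

theorem EquivUpTo.symm {n : ℕ} {P Q : LaurentSeries ℤ} (h : EquivUpTo n P Q) :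
    EquivUpTo n Q P := by
  obtain ⟨ε, h⟩ := h
  refine ⟨ε, fun j hj => ?_⟩
  rw [h j hj, ← mul_assoc, ← Units.val_mul, Int.units_mul_self, Units.val_one, one_mul]

theorem EquivUpTo.trans {n : ℕ} {P Q R : LaurentSeries ℤ} (h : EquivUpTo n P Q)
    (h' : EquivUpTo n Q R) : EquivUpTo n P R := by
  obtain ⟨ε, h⟩ := h
  obtain ⟨ε', h'⟩ := h'
  refine ⟨ε * ε', fun j hj => ?_⟩
  rw [h j hj, h' j hj, Units.val_mul, mul_assoc]

theorem EquivUpTo.mono {m n : ℕ} {P Q : LaurentSeries ℤ} (h : EquivUpTo n P Q) (hmn : m ≤ n) :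
    EquivUpTo m P Q := by
  obtain ⟨ε, h⟩ := h
  exact ⟨ε, fun j hj => h j (hj.trans_le hmn)⟩

/-- A strictly increasing rate satisfies `n ≤ f n`, so both tails can be compared with the term of
index `n`. -/
theorem IsTailWithRate.equivUpTo {P : ℕ → LaurentSeries ℤ} {f g : ℕ → ℕ} {T T' : PowerSeries ℤ}
    (h : IsTailWithRate P f T) (h' : IsTailWithRate P g T') (n : ℕ) :
    EquivUpTo n (HahnSeries.ofPowerSeries ℤ ℤ T) (HahnSeries.ofPowerSeries ℤ ℤ T') :=
  ((h.2 n).mono h.1.le_apply).trans ((h'.2 n).mono h'.1.le_apply).symm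

theorem order_single_mul_ofPowerSeries {U : PowerSeries ℤ} (hU : PowerSeries.constantCoeff U = 1)
    (ε : ℤˣ) (m : ℤ) :
    (HahnSeries.single m (ε : ℤ) * HahnSeries.ofPowerSeries ℤ ℤ U).order = m := by
  have hε : (ε : ℤ) ≠ 0 := ε.ne_zero
  have hU0 : HahnSeries.ofPowerSeries ℤ ℤ U ≠ 0 := by
    intro h
    rw [map_eq_zero_iff _ HahnSeries.ofPowerSeries_injective] at h
    simp [h] at hU
  rw [HahnSeries.order_mul (HahnSeries.single_ne_zero hε) hU0, HahnSeries.order_single hε]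
  suffices (HahnSeries.ofPowerSeries ℤ ℤ U).order = 0 by simp [this]
  apply le_antisymm
  · apply HahnSeries.order_le_of_coeff_ne_zero
    rw [PowerSeries.coeff_coe]
    simp [hU]
  · rw [HahnSeries.le_order_iff_forall hU0]
    intro j hj
    rw [PowerSeries.coeff_coe, if_pos hj]

/-- Constant terms `1` fix the lowest exponents, so that congruence modulo `X ^ n` compares the
right coefficients. -/
theorem equivUpTo_of_dvd {n : ℕ} {U V : PowerSeries ℤ} (hU : PowerSeries.constantCoeff U = 1)
    (hV : PowerSeries.constantCoeff V = 1) (h : PowerSeries.X ^ n ∣ U - V) (ε : ℤˣ) (m : ℤ) :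
    EquivUpTo n (HahnSeries.ofPowerSeries ℤ ℤ U)
      (HahnSeries.single m (ε : ℤ) * HahnSeries.ofPowerSeries ℤ ℤ V) := by
  have hU' : (HahnSeries.ofPowerSeries ℤ ℤ U).order = 0 := by
    simpa using order_single_mul_ofPowerSeries hU 1 0
  refine ⟨ε, fun j hj => ?_⟩
  have hc := PowerSeries.X_pow_dvd_iff.1 h j hj
  rw [map_sub, sub_eq_zero] at hc
  rw [hU', order_single_mul_ofPowerSeries hV, add_comm m, HahnSeries.coeff_single_mul_add, zero_add,
    ← mul_assoc, ← Units.val_mul, Int.units_mul_self, Units.val_one, one_mul]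
  have e1 := HahnSeries.ofPowerSeries_apply_coeff (Γ := ℤ) U j
  have e2 := HahnSeries.ofPowerSeries_apply_coeff (Γ := ℤ) V j
  rw [e1, e2, hc]

/-! ### The Jones polynomial as a state sum. -/

namespace DiagramCode

open LaurentPolynomial

variable {X : Type*} [Fintype X] [DecidableEq X] {D : DiagramCode X}

theorem stateOf_bijective : Function.Bijective (stateOf : Finset X → X → Bool) := by
  constructor
  · intro S S' h
    ext x
    simpa [stateOf] using congrFun h x
  · intro s
    exact ⟨Finset.univ.filter fun x => s x = true, by funext x; simp [stateOf]⟩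

theorem bracket_eq_sum (D : DiagramCode X) :
    D.bracket = ∑ S : Finset X, T (2 * S.card - Fintype.card X) *
      (-T 2 - T (-2)) ^ D.stateCircles (stateOf S) := by
  rw [bracket, ← stateOf_bijective.sum_comp]
  refine Finset.sum_congr rfl fun S _ => ?_
  congr 2
  have h : ∀ x, (if stateOf S x = true then (1 : ℤ) else -1) = 2 * (if x ∈ S then 1 else 0) - 1 := by
    intro x
    by_cases hx : x ∈ S <;> simp [stateOf, hx]
  simp [h, Finset.sum_sub_distrib, mul_comm]

/-- The substitution `q ↦ A⁴`. -/
noncomputable def substFour : ℤ[T;T⁻¹] →+* ℤ[T;T⁻¹] :=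
  AddMonoidAlgebra.mapDomainRingHom ℤ (AddMonoidHom.mulLeft (4 : ℤ))

theorem substFour_apply (P : ℤ[T;T⁻¹]) :
    substFour P = AddMonoidAlgebra.mapDomain (fun j : ℤ => 4 * j) P := rfl

theorem substFour_T (n : ℤ) : substFour (T n) = T (4 * n) := by
  rw [substFour_apply]
  exact AddMonoidAlgebra.mapDomain_single

theorem substFour_injective : Function.Injective substFour :=
  AddMonoidAlgebra.mapDomain_injective fun a b h => by
    simpa using h

/-- The Jones polynomial of a diagram in a form normalized by means of a function `κ` such that
each state `S` has `2 κ S + |S|` circles up to a constant. -/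
noncomputable def jonesSum (D : DiagramCode X) (κ : Finset X → ℕ) : ℤ[T;T⁻¹] :=
  ∑ S : Finset X, T (-κ S) * (-(1 + T 1)) ^ (D.stateCircles (stateOf S) - 1)

theorem stateCircles_pos [Nonempty X] (s : X → Bool) : 1 ≤ D.stateCircles s := by
  have : Nonempty (Quot (D.stateRel s)) := ⟨Quot.mk _ (Classical.arbitrary X, 0)⟩
  have : 0 < D.loops s := Nat.card_pos
  rw [stateCircles_eq]
  lia

section

variable {κ : Finset X → ℕ} {v : ℕ}

theorem bracket_eq_mul_substFour [Nonempty X]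
    (h : ∀ S, D.loops (stateOf S) + v = 2 * κ S + S.card) :
    D.bracket = (-T 2 - T (-2)) * T (2 + 2 * v - 2 * D.circles - Fintype.card X) *
      substFour (jonesSum D κ) := by
  rw [bracket_eq_sum, jonesSum, map_sum, Finset.mul_sum]
  refine Finset.sum_congr rfl fun S _ => ?_
  have h1 := h S
  have h2 := stateCircles_pos (D := D) (stateOf S)
  have h3 := stateCircles_eq D (stateOf S)
  obtain ⟨n, hn⟩ : ∃ n, D.stateCircles (stateOf S) = n + 1 := ⟨_, (Nat.sub_add_cancel h2).symm⟩
  rw [hn] at h3 ⊢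
  have hδ : (-T 2 - T (-2) : ℤ[T;T⁻¹]) = T (-2) * -(1 + T 4) := by
    rw [mul_neg, mul_add, ← T_add, mul_one]
    norm_num
    ring
  have hs : substFour (-(1 + T 1)) = -(1 + T 4) := by simp [substFour_T]
  rw [map_mul, map_pow, hs, substFour_T, Nat.add_sub_cancel, pow_succ, hδ, mul_pow, T_pow]
  -- The circle count cancels `|S|`, so the remaining exponent of `A` depends on `S` only through
  -- `-4 κ S`; this is why powers of `q = A⁴` suffice.
  have he : (2 * (S.card : ℤ) - Fintype.card X) =
      (2 + 2 * v - 2 * D.circles - Fintype.card X) + 4 * -(κ S : ℤ) - n * (-2) := by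
    have : ((n : ℤ) + 1 - D.circles) + v = 2 * κ S + S.card := by
      zify at h1 h3
      linarith
    linarith
  rw [he, sub_eq_add_neg _ ((n : ℤ) * (-2)), T_add, T_add]
  have hc : T (-((n : ℤ) * (-2))) * T ((n : ℤ) * (-2)) = (1 : ℤ[T;T⁻¹]) := by
    rw [← T_add, neg_add_cancel, T_zero]
  linear_combination (T (2 + 2 * v - 2 * D.circles - Fintype.card X) * T (4 * -(κ S : ℤ)) *
    (-(1 + T 4)) ^ n * (T (-2) * -(1 + T 4))) * hc

theorem isJonesPolynomial_jonesSum [Nonempty X]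
    (h : ∀ S, D.loops (stateOf S) + v = 2 * κ S + S.card) :
    D.IsJonesPolynomial (jonesSum D κ) := by
  refine ⟨1, -(2 + 2 * v - 2 * D.circles - Fintype.card X), ?_⟩
  rw [bracket_eq_mul_substFour h, ← substFour_apply]
  have hc : T (-(2 + 2 * v - 2 * D.circles - Fintype.card X)) *
      T (2 + 2 * v - 2 * D.circles - Fintype.card X) = (1 : ℤ[T;T⁻¹]) := by
    rw [← T_add, neg_add_cancel, T_zero]
  rw [Units.val_one, map_one]
  linear_combination (-(-T 2 - T (-2)) * substFour (jonesSum D κ)) * hc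

/-- Both substituted polynomials are supported on multiples of `4`, so a nonzero coefficient forces
the shift to be one too. Hence the unit `± A ^ m` descends to a unit in `q`. -/
theorem four_dvd_of_substFour_eq {P Q : ℤ[T;T⁻¹]} {a m : ℤ} (hP : P ≠ 0)
    (h : substFour P = C a * T m * substFour Q) : 4 ∣ m := by
  by_contra hm
  obtain ⟨j, hj⟩ : ∃ j, P.coeff j ≠ 0 := by
    by_contra! h0
    exact hP (LaurentPolynomial.ext h0)
  apply hj
  have h1 : (substFour P).coeff (4 * j) = P.coeff j :=
    Finsupp.mapDomain_apply (f := fun j : ℤ => 4 * j) (fun a b h => by simpa using h) _ _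
  rw [← h1, h, ← single_eq_C_mul_T, AddMonoidAlgebra.coeff_single_mul_apply]
  have h2 : (substFour Q).coeff (-m + 4 * j) = 0 :=
    Finsupp.mapDomain_of_notMem_range (f := fun j : ℤ => 4 * j) _ _ (by
      rintro ⟨i, hi⟩
      simp only at hi
      exact hm ⟨j - i, by linarith⟩)
  rw [h2, mul_zero]

theorem IsJonesPolynomial.eq_jonesSum [Nonempty X]
    (h : ∀ S, D.loops (stateOf S) + v = 2 * κ S + S.card) (h0 : jonesSum D κ ≠ 0)
    {P : ℤ[T;T⁻¹]} (hP : D.IsJonesPolynomial P) :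
    ∃ (ε : ℤˣ) (m : ℤ), P = C (ε : ℤ) * T m * jonesSum D κ := by
  obtain ⟨ε, m, hm⟩ := hP
  have hδ : (-T 2 - T (-2) : ℤ[T;T⁻¹]) ≠ 0 := by
    intro h
    have := congrArg (fun p : ℤ[T;T⁻¹] => p.coeff 2) h
    simp [AddMonoidAlgebra.coeff_sub, AddMonoidAlgebra.coeff_neg] at this
  rw [bracket_eq_mul_substFour h, ← substFour_apply] at hm
  set m' := m + (2 + 2 * v - 2 * D.circles - Fintype.card X) with hm'
  have hP : substFour P = C (ε : ℤ) * T m' * substFour (jonesSum D κ) := by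
    apply mul_right_cancel₀ hδ
    rw [hm, hm', T_add]
    ring
  have hC : (C (ε : ℤ) : ℤ[T;T⁻¹]) ≠ 0 := (ε.isUnit.map C).ne_zero
  have hP0 : P ≠ 0 := by
    rintro rfl
    rw [map_zero] at hP
    refine mul_ne_zero (mul_ne_zero hC (isUnit_T m').ne_zero) ?_ hP.symm
    rwa [Ne, map_eq_zero_iff _ substFour_injective]
  obtain ⟨n, hn⟩ := four_dvd_of_substFour_eq hP0 hP
  refine ⟨ε, n, substFour_injective ?_⟩
  rw [hP, hn, map_mul, map_mul, substFour_T, eq_intCast C, map_intCast]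

/-- The Jones polynomial as a sum over sets of crossings, after clearing denominators. -/
theorem jonesSum_mul [Nonempty X] (h : ∀ S, D.loops (stateOf S) + v = 2 * κ S + S.card)
    (hκ : ∀ S, κ S ≤ v) :
    jonesSum D κ * (1 + T 1) ^ (v + 1) = C ((-1 : ℤ) ^ (v + D.circles + 1)) * T (-v) *
      Polynomial.toLaurent ((1 + Polynomial.X) ^ D.circles * ∑ S : Finset X,
        Polynomial.X ^ (v - κ S) * (1 + Polynomial.X) ^ (2 * κ S) *
          (-(1 + Polynomial.X)) ^ S.card) := by
  rw [map_mul, map_sum, Finset.mul_sum, Finset.mul_sum, jonesSum, Finset.sum_mul]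
  refine Finset.sum_congr rfl fun S _ => ?_
  have h1 := h S
  have h2 := stateCircles_pos (D := D) (stateOf S)
  have h3 := stateCircles_eq D (stateOf S)
  obtain ⟨n, hn⟩ : ∃ n, D.stateCircles (stateOf S) = n + 1 := ⟨_, (Nat.sub_add_cancel h2).symm⟩
  rw [hn] at h3 ⊢
  simp only [map_mul, map_pow, map_neg, map_add, map_one, Polynomial.toLaurent_X, Nat.add_sub_cancel]
  rw [T_pow, neg_pow (1 + T 1 : ℤ[T;T⁻¹]) n, neg_pow (1 + T 1 : ℤ[T;T⁻¹]) S.card]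
  have hT : (T (-v) * T (((v - κ S : ℕ) : ℤ) * 1) : ℤ[T;T⁻¹]) = T (-κ S) := by
    rw [← T_add]
    congr 1
    have := hκ S
    push_cast [this]
    ring
  -- The circle count again; the exponent `v + 1` absorbs `-v` and the one circle divided out.
  have hpow : ((1 + T 1) ^ D.circles * (1 + T 1) ^ (2 * κ S) * (1 + T 1) ^ S.card : ℤ[T;T⁻¹]) =
      (1 + T 1) ^ n * (1 + T 1) ^ (v + 1) := by
    rw [← pow_add, ← pow_add, ← pow_add]
    congr 1
    lia
  have hsign : ((-1) ^ (v + D.circles + 1) * (-1) ^ S.card : ℤ[T;T⁻¹]) = (-1) ^ n := by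
    rw [← pow_add]
    exact neg_one_pow_congr (by grind)
  rw [← hT, ← hsign]
  linear_combination (-(-1) ^ (v + D.circles + 1) * (-1) ^ S.card * T (-v) *
    T (((v - κ S : ℕ) : ℤ) * 1)) * hpow

end

end DiagramCode

/-! ### Weights of parallelism classes. -/

namespace DiagramCode

variable {X : Type*} [Fintype X] [DecidableEq X] {D : DiagramCode X}

/-- The contribution of the circles to the summand of `S` in the Jones polynomial. -/
noncomputable def edgeWeight (D : DiagramCode X) (S : Finset X) : Polynomial ℤ :=
  Polynomial.X ^ (D.joinCount ∅ - D.joinCount S) * (1 + Polynomial.X) ^ (2 * D.joinCount S)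

open Classical in
/-- The sum over the sets of edges without loops in which the edge `x` has the weight `a x - 1`. -/
noncomputable def edgeSum (D : DiagramCode X) (a : X → Polynomial ℤ) : Polynomial ℤ :=
  ∑ S ∈ (Finset.univ.filter fun x => ¬ D.IsLoop x).powerset,
    D.edgeWeight S * ∏ x ∈ S, (a x - 1)

theorem X_dvd_edgeWeight {x : X} (hx : ¬ D.IsLoop x) {S : Finset X} (hS : x ∈ S) :
    Polynomial.X ∣ D.edgeWeight S :=
  (dvd_pow_self _ (Nat.sub_ne_zero_of_lt (joinCount_lt_of_not_isLoop hx hS))).mul_right _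

theorem constantCoeff_edgeSum (a : X → Polynomial ℤ) :
    PowerSeries.constantCoeff (D.edgeSum a : PowerSeries ℤ) = 1 := by
  have h : (D.edgeSum a).eval 0 = 1 := by
    classical
    rw [edgeSum, Polynomial.eval_finsetSum, Finset.sum_eq_single ∅]
    · simp [edgeWeight]
    · intro S hS hne
      obtain ⟨x, hx⟩ := Finset.nonempty_iff_ne_empty.2 hne
      have hx' := (Finset.mem_filter.1 (Finset.mem_powerset.1 hS hx)).2
      obtain ⟨g, hg⟩ := X_dvd_edgeWeight hx' hx
      simp [hg]
    · simp
  rw [← PowerSeries.coeff_zero_eq_constantCoeff_apply, Polynomial.coeff_coe,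
    Polynomial.coeff_zero_eq_eval_zero, h]

/-- The term of the empty set cancels, and every other term carries a factor `X` from its edge
weight: the source of the `+ 1` in the rate. -/
theorem X_pow_dvd_edgeSum_sub {a b : X → Polynomial ℤ} {n : ℕ}
    (h : ∀ x, Polynomial.X ^ n ∣ a x - b x) :
    Polynomial.X ^ (n + 1) ∣ D.edgeSum a - D.edgeSum b := by
  classical
  rw [edgeSum, edgeSum, ← Finset.sum_sub_distrib]
  refine Finset.dvd_sum fun S hS => ?_
  rw [← mul_sub]
  rcases S.eq_empty_or_nonempty with rfl | ⟨x, hx⟩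
  · simp
  · have hx' := (Finset.mem_filter.1 (Finset.mem_powerset.1 hS hx)).2
    rw [pow_succ']
    exact mul_dvd_mul (X_dvd_edgeWeight hx' hx)
      (dvd_prod_sub_prod S _ _ fun x _ => by simpa using h x)

-- Here `w = -(1 + X)`, so `1 + w = -X`: a loop class, met or not, contributes in total the monomial
-- `(-X) ^ N x`.
open Classical in
theorem sum_edgeWeight_image {Y : Type*} [Fintype Y] [DecidableEq Y] (p : Y → X) (N : X → ℕ)
    (hN : ∀ x, N x = (Finset.univ.filter fun y => p y = x).card) :
    ∑ S : Finset Y, D.edgeWeight (S.image p) * (-(1 + Polynomial.X)) ^ S.card =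
      (∏ x with D.IsLoop x, (-Polynomial.X) ^ N x) *
        D.edgeSum fun x => (-Polynomial.X) ^ N x := by
  have h1 : (1 + -(1 + Polynomial.X) : Polynomial ℤ) = -Polynomial.X := by ring
  rw [sum_image_eq p _ D.edgeWeight, h1]
  have h2 := sum_powerset_union_loops (Finset.univ.filter fun x => ¬ D.IsLoop x)
    (Finset.univ.filter fun x => D.IsLoop x) (Finset.disjoint_filter_filter_not _ _ _).symm
    D.edgeWeight (fun x hx S => by
      simp [edgeWeight, joinCount_insert_of_isLoop (Finset.mem_filter.1 hx).2])
    (fun x => (-Polynomial.X) ^ N x - 1)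
  simp only [add_sub_cancel] at h2
  rw [edgeSum, ← h2, Finset.union_comm, Finset.filter_union_filter_not_eq, Finset.powerset_univ]
  simp only [hN]

/-- The Jones polynomial of a twisted diagram as a power series, up to a unit. -/
theorem exists_laurentPolynomialToSeries_eq [Nonempty X] (halt : D.IsAlternating)
    (hplanar : D.IsPlanar) (e : X → ℕ) {p : X → X}
    (hp : ∀ S, D.joinCount (S.image p) = D.joinCount S) {N : X → ℕ}
    (hN : ∀ x, N x = (Finset.univ.filter fun z : Σ x, Fin (e x + 1) => p z.1 = x).card)
    {u : PowerSeries ℤ} (hu : u * (1 + PowerSeries.X) = 1) {P : ℤ[T;T⁻¹]}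
    (hP : (D.insertTwists e).IsJonesPolynomial P) :
    ∃ (ε : ℤˣ) (m : ℤ), laurentPolynomialToSeries P = HahnSeries.single m (ε : ℤ) *
      HahnSeries.ofPowerSeries ℤ ℤ (u ^ (D.joinCount ∅ + 1) * (1 + PowerSeries.X) ^ D.circles *
        ((D.edgeSum fun x => (-Polynomial.X) ^ N x : Polynomial ℤ) : PowerSeries ℤ)) := by
  classical
  have : Nonempty (Σ x, Fin (e x + 1)) := ⟨⟨Classical.arbitrary X, 0⟩⟩
  set v := D.joinCount ∅ with hv
  set W := D.edgeSum fun x => (-Polynomial.X) ^ N x with hW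
  let q : (Σ x, Fin (e x + 1)) → X := fun z => p z.1
  let κ : Finset (Σ x, Fin (e x + 1)) → ℕ := fun S => D.joinCount (S.image q)
  have hκ : ∀ S, (D.insertTwists e).loops (stateOf S) + v = 2 * κ S + S.card := by
    intro S
    rw [loops_insertTwists_add D e halt hplanar, ← hp, Finset.image_image]
    rfl
  have hκv : ∀ S, κ S ≤ v := fun S => joinCount_anti (Finset.empty_subset _)
  have hsum := sum_edgeWeight_image (D := D) q N hN
  rw [← hW, Finset.prod_pow_eq_pow_sum] at hsum
  set M := ∑ x with D.IsLoop x, N x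
  have hmul : jonesSum (D.insertTwists e) κ * (1 + LaurentPolynomial.T 1) ^ (v + 1) =
      LaurentPolynomial.C ((-1 : ℤ) ^ (v + D.circles + 1)) * LaurentPolynomial.T (-v) *
      Polynomial.toLaurent ((1 + Polynomial.X) ^ D.circles * ((-Polynomial.X) ^ M * W)) := by
    rw [← hsum]
    exact jonesSum_mul hκ hκv
  have hW0 : W ≠ 0 := by
    intro h0
    have := constantCoeff_edgeSum (D := D) fun x => (-Polynomial.X) ^ N x
    rw [← hW, h0] at this
    simp at this
  have hX1 : (1 + Polynomial.X : Polynomial ℤ) ≠ 0 := by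
    intro h0
    simpa using congrArg (Polynomial.eval 0) h0
  have hJ0 : jonesSum (D.insertTwists e) κ ≠ 0 := by
    intro h0
    rw [h0, zero_mul] at hmul
    refine mul_ne_zero (mul_ne_zero ?_ ?_) ?_ hmul.symm
    · exact ((isUnit_one.neg.pow _).map LaurentPolynomial.C).ne_zero
    · exact (LaurentPolynomial.isUnit_T _).ne_zero
    · rw [Ne, map_eq_zero_iff _ Polynomial.toLaurent_injective]
      exact mul_ne_zero (pow_ne_zero _ hX1)
        (mul_ne_zero (pow_ne_zero _ (neg_ne_zero.2 Polynomial.X_ne_zero)) hW0)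
  obtain ⟨ε, m, rfl⟩ := hP.eq_jonesSum hκ hJ0
  -- The `M` loop edges contribute `(-q) ^ M`, hence both a sign and a shift.
  refine ⟨ε * (-1) ^ (v + D.circles + 1 + M), m - v + M, ?_⟩
  have hser := congrArg laurentPolynomialToSeriesHom hmul
  have hC : ∀ a : ℤ, laurentPolynomialToSeriesHom (LaurentPolynomial.C a) = HahnSeries.C a :=
    fun a => by rw [eq_intCast, map_intCast, eq_intCast]
  have hT : ∀ n : ℤ, laurentPolynomialToSeriesHom (LaurentPolynomial.T n) =
      HahnSeries.single n 1 :=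
    fun n => by rw [laurentPolynomialToSeriesHom_apply, laurentPolynomialToSeries_T]
  have hL : ∀ g : Polynomial ℤ, laurentPolynomialToSeriesHom (Polynomial.toLaurent g) =
      HahnSeries.ofPowerSeries ℤ ℤ (g : PowerSeries ℤ) :=
    fun g => by rw [laurentPolynomialToSeriesHom_apply, laurentPolynomialToSeries_toLaurent]
  have h1T : laurentPolynomialToSeriesHom (1 + LaurentPolynomial.T 1) =
      HahnSeries.ofPowerSeries ℤ ℤ (1 + PowerSeries.X) := by
    rw [map_add, RingHom.map_one, hT, map_add, RingHom.map_one, HahnSeries.ofPowerSeries_X]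
  rw [map_mul, map_pow, h1T, map_mul, map_mul, hC, hT, hL] at hser
  rw [← laurentPolynomialToSeriesHom_apply, map_mul, map_mul, hC, hT]
  have hu' : HahnSeries.ofPowerSeries ℤ ℤ u ^ (v + 1) *
      HahnSeries.ofPowerSeries ℤ ℤ (1 + PowerSeries.X) ^ (v + 1) = 1 := by
    rw [← mul_pow, ← map_mul, hu, map_one, one_pow]
  have hsingle : HahnSeries.single (m - v + M) ((ε * (-1) ^ (v + D.circles + 1 + M) : ℤˣ) : ℤ) =
      HahnSeries.C (ε : ℤ) * HahnSeries.single m (1 : ℤ) *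
        (HahnSeries.C ((-1 : ℤ) ^ (v + D.circles + 1)) * HahnSeries.single (-v : ℤ) (1 : ℤ)) *
        HahnSeries.ofPowerSeries ℤ ℤ (-PowerSeries.X) ^ M := by
    have hX : HahnSeries.ofPowerSeries ℤ ℤ (-PowerSeries.X) ^ M =
        HahnSeries.single (M : ℤ) ((-1 : ℤ) ^ M) := by
      rw [map_neg, HahnSeries.ofPowerSeries_X, ← HahnSeries.single_neg, HahnSeries.single_pow]
      simp
    rw [hX, HahnSeries.C_apply, HahnSeries.C_apply, HahnSeries.single_mul_single,
      HahnSeries.single_mul_single, HahnSeries.single_mul_single, HahnSeries.single_mul_single]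
    refine congrArg₂ (fun a b => HahnSeries.single a b) (by ring) ?_
    simp only [Units.val_mul, Units.val_pow_eq_pow_val, Units.val_neg, Units.val_one]
    ring
  rw [hsingle]
  simp only [Polynomial.coe_mul, Polynomial.coe_pow, Polynomial.coe_add, Polynomial.coe_one,
    Polynomial.coe_X, Polynomial.coe_neg, RingHom.map_mul, RingHom.map_pow] at hser ⊢
  linear_combination (HahnSeries.C (ε : ℤ) * HahnSeries.single m (1 : ℤ) *
      HahnSeries.ofPowerSeries ℤ ℤ u ^ (v + 1)) * hser -
    (HahnSeries.C (ε : ℤ) * HahnSeries.single m (1 : ℤ) *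
      laurentPolynomialToSeriesHom (jonesSum (D.insertTwists e) κ)) * hu'

/-! ### The twists of a diagram with twist regions -/

section

variable {r : ℕ} {k : Fin r → ℕ} (R : ∀ j, D.NegativeTwistRegion (k j))

open Classical in
/-- The top crossing of the twist region that contains `x`, or `x` itself if there is none. -/
noncomputable def regionTop (x : X) : X :=
  if h : ∃ j, x ∈ Set.range (R j).crossing then (R h.choose).top else x

theorem joinCount_image_regionTop (S : Finset X) :
    D.joinCount (S.image (regionTop R)) = D.joinCount S := by
  refine joinCount_image (fun S x => ?_) S
  unfold regionTop
  split_ifs with h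
  · obtain ⟨t, ht⟩ := h.choose_spec
    conv_lhs => rw [← ht]
    exact (R h.choose).joinRel_pair S _ _
  · rfl

theorem regionTop_crossing
    (hdisj : ∀ j j', j ≠ j' → Disjoint (Set.range (R j).crossing) (Set.range (R j').crossing))
    (j : Fin r) (t : Fin (k j)) : regionTop R ((R j).crossing t) = (R j).top := by
  have h : ∃ j', (R j).crossing t ∈ Set.range (R j').crossing := ⟨j, t, rfl⟩
  have hj : h.choose = j := by
    by_contra hne
    exact Set.disjoint_left.1 (hdisj _ _ hne) h.choose_spec ⟨t, rfl⟩
  rw [regionTop, dif_pos h, hj]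

theorem top_mem_range (j : Fin r) : (R j).top ∈ Set.range (R j).crossing := ⟨_, rfl⟩

/-- The number of crossings of the twisted diagram in the parallelism class of `x`. -/
noncomputable def classCard (b : Fin r → ℕ) (x : X) : ℕ :=
  (Finset.univ.filter fun z : Σ x, Fin (extraTwists R b x + 1) => regionTop R z.1 = x).card

theorem classCard_eq (b : Fin r → ℕ) (x : X) :
    classCard R b x = (Finset.univ.filter fun y => regionTop R y = x).card +
      ∑ y with regionTop R y = x, extraTwists R b y := by
  have : (Finset.univ.filter fun z : Σ x, Fin (extraTwists R b x + 1) => regionTop R z.1 = x) =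
      (Finset.univ.filter fun y => regionTop R y = x).sigma fun _ => Finset.univ := by
    ext z; simp
  rw [classCard, this, Finset.card_sigma]
  simp [Finset.sum_add_distrib, add_comm]

/-- New crossings sit only at tops of regions, and `regionTop` sends a top to a top. -/
theorem classCard_of_ne_top {x : X} (hx : ∀ j, (R j).top ≠ x) (b : Fin r → ℕ) :
    classCard R b x = (Finset.univ.filter fun y => regionTop R y = x).card := by
  rw [classCard_eq, Nat.add_eq_left]
  refine Finset.sum_eq_zero fun y hy => Finset.sum_eq_zero fun j _ => if_neg ?_
  rintro rfl
  have hy := (Finset.mem_filter.1 hy).2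
  rw [regionTop, dif_pos ⟨j, top_mem_range R j⟩] at hy
  exact hx _ hy

theorem le_classCard_top
    (hdisj : ∀ j j', j ≠ j' → Disjoint (Set.range (R j).crossing) (Set.range (R j').crossing))
    (b : Fin r → ℕ) (j : Fin r) : k j + b j ≤ classCard R b (R j).top := by
  rw [classCard_eq]
  refine add_le_add ?_ ?_
  · have h : Finset.univ.image (R j).crossing ⊆
        Finset.univ.filter fun y => regionTop R y = (R j).top := by
      intro y hy
      obtain ⟨t, -, rfl⟩ := Finset.mem_image.1 hy
      simp [regionTop_crossing R hdisj]
    simpa [Finset.card_image_of_injective _ (R j).crossing_injective] using Finset.card_le_card h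
  · have h1 : b j ≤ extraTwists R b (R j).top := by
      refine le_trans ?_ (Finset.single_le_sum
        (f := fun j' => if (R j').top = (R j).top then b j' else 0) (fun _ _ => Nat.zero_le _)
        (Finset.mem_univ j))
      simp
    have h2 : (R j).top ∈ Finset.univ.filter fun y => regionTop R y = (R j).top := by
      rw [Finset.mem_filter]
      exact ⟨Finset.mem_univ _, regionTop_crossing R hdisj j _⟩
    exact h1.trans (Finset.single_le_sum (f := extraTwists R b) (fun _ _ => Nat.zero_le _) h2)

open Classical in
/-- The limit of `(-q) ^ N`, where `N` is the size of the parallelism class of `x`, when the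
numbers of crossings of all twist regions tend to infinity. -/
noncomputable def limitWeight (x : X) : Polynomial ℤ :=
  if ∃ j, (R j).top = x then 0 else (-Polynomial.X) ^ classCard R 0 x

theorem X_pow_dvd_sub_limitWeight
    (hdisj : ∀ j j', j ≠ j' → Disjoint (Set.range (R j).crossing) (Set.range (R j').crossing))
    {n : ℕ} {b : Fin r → ℕ} (h : ∀ j, n ≤ k j + b j) (x : X) :
    (Polynomial.X : Polynomial ℤ) ^ n ∣ (-Polynomial.X) ^ classCard R b x - limitWeight R x := by
  unfold limitWeight
  split_ifs with hx
  · obtain ⟨j, rfl⟩ := hx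
    rw [sub_zero, neg_pow]
    exact (pow_dvd_pow _ ((h j).trans (le_classCard_top R hdisj b j))).mul_left _
  · push Not at hx
    rw [classCard_of_ne_top R hx, classCard_of_ne_top R hx, sub_self]
    exact dvd_zero _

end

end DiagramCode

/-! ### The stabilization theorem. -/

open DiagramCode

theorem corollary3p8 {X : Type*} [Fintype X] [DecidableEq X] (L : DiagramCode X)
    (hplanar : L.IsPlanar) (halt : L.IsAlternating)
    {r : ℕ} {k : Fin r → ℕ} (R : ∀ j, L.NegativeTwistRegion (k j))
    (hdisj : ∀ j j', j ≠ j' → Disjoint (Set.range (R j).crossing) (Set.range (R j').crossing))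
    (kmin : ℕ) (hkmin : IsLeast (Set.range k) kmin) :
    (∀ i : ℕ, ∃ P, (L.twist R fun _ => i).IsJonesPolynomial P) ∧
    ∀ J : ℕ → LaurentPolynomial ℤ, (∀ i, (L.twist R fun _ => i).IsJonesPolynomial (J i)) →
      StabilizesWithRate (fun i => laurentPolynomialToSeries (J i)) (fun i => kmin + i + 1) ∧
      ∀ f g T T', IsTailWithRate (fun i => laurentPolynomialToSeries (J i)) f T →
        IsTailWithRate (fun i => laurentPolynomialToSeries (J i)) g T' →
        ∀ n, EquivUpTo n (HahnSeries.ofPowerSeries ℤ ℤ T) (HahnSeries.ofPowerSeries ℤ ℤ T') := by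
  obtain ⟨j₀, -⟩ := hkmin.1
  have : Nonempty X := ⟨(R j₀).top⟩
  refine ⟨fun i => ?_, fun J hJ => ⟨?_, fun f g T T' hT hT' n => hT.equivUpTo hT' n⟩⟩
  · have : Nonempty (Σ x, Fin (extraTwists R (fun _ => i) x + 1)) := ⟨⟨(R j₀).top, 0⟩⟩
    exact ⟨_, isJonesPolynomial_jonesSum
      (loops_insertTwists_add L (extraTwists R fun _ => i) halt hplanar)⟩
  · obtain ⟨u, hu⟩ : ∃ u : PowerSeries ℤ, u * (1 + PowerSeries.X) = 1 := by
      have : IsUnit (1 + PowerSeries.X : PowerSeries ℤ) := by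
        rw [PowerSeries.isUnit_iff_constantCoeff]
        simp
      exact this.exists_left_inv
    have hu0 : PowerSeries.constantCoeff u = 1 := by
      simpa using congrArg PowerSeries.constantCoeff hu
    set F := u ^ (L.joinCount ∅ + 1) * (1 + PowerSeries.X) ^ L.circles with hF
    have hF0 : ∀ a, PowerSeries.constantCoeff (F * (L.edgeSum a : PowerSeries ℤ)) = 1 := by
      intro a
      rw [map_mul, constantCoeff_edgeSum]
      simp [hF, hu0]
    -- The tail: each marked class has edge weight `0 - 1 = -1`. The factor `F` does not depend on
    -- `i`, since twisting changes neither `v` nor the crossingless circles.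
    refine ⟨F * (L.edgeSum (limitWeight R) : PowerSeries ℤ), fun a b hab => by lia, fun i => ?_⟩
    obtain ⟨ε, m, hm⟩ := exists_laurentPolynomialToSeries_eq halt hplanar
      (extraTwists R fun _ => i) (joinCount_image_regionTop R)
      (N := classCard R fun _ => i) (fun _ => rfl) hu (hJ i)
    simp only [hm]
    refine equivUpTo_of_dvd (hF0 _) (hF0 _) ?_ ε m
    rw [← mul_sub, ← neg_sub, mul_neg, dvd_neg]
    refine Dvd.dvd.mul_left ?_ _
    have h := X_pow_dvd_edgeSum_sub (D := L) (X_pow_dvd_sub_limitWeight R hdisj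
      (n := kmin + i) (b := fun _ => i) fun j =>
        Nat.add_le_add_right (hkmin.2 ⟨j, rfl⟩) i)
    simpa using map_dvd Polynomial.coeToPowerSeries.ringHom h
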